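/- All graphs are finite and simple. For a graph $G$ and $D\subseteq V(G)$, let $N[D]$ be the set of vertices that are in $D$ or adjacent to a vertex of $D$. The cycle isolation number $\iota(G,\mathcal C)$ is the smallest size of a set $D\subseteq V(G)$ such that $G-N[D]$ contains no cycle as a subgraph. For an integer $m\ge 0$, write $m+1=5q+r$ with integers $q\ge 0$ and $0\le r\le 4$. If $q=0$, an $(m,3)$-special graph is a tree with $m$ edges. If $q\ge1$, take distinct vertices $v_1,\dots,v_q$ and pairwise disjoint $3$-element sets $U_1,\dots,U_q$ that contain none of the $v_j$; for each $i$ let $G_i$ be the graph with vertex set $U_i\cup\{v_i\}$ that consists of a triangle on $U_i$ and one edge joining $v_i$ to one vertex of $U_i$; let $T$ be a tree with vertex set $\{v_1,\dots,v_q\}$, and let $T'$ be a tree with exactly $r$ edges such that $V(T')\cap\bigcup_{i=1}^q V(G_i)=\{v_q\}$. Then the graph with vertex set $V(T')\cup\bigcup_{i=1}^q V(G_i)$ and edge set $E(T)\cup E(T')\cup\bigcup_{i=1}^q E(G_i)$ is called an $(m,3)$-special graph. An $(m,3)$-special graph is pure if $r=0$. Let $G$ be a connected graph with exactly $m$ edges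 that is not a triangle (that is, not isomorphic to $C_3$). Then \[\iota(G,\mathcal C)\le\frac{m+1}{5}.\] Moreover: (i) $\iota(G,\mathcal C)=\frac{m+1}{5}$ if and only if $G$ is a pure $(m,3)$-special graph or $G$ is a $4$-cycle. (ii) If $G$ is an $(m,3)$-special graph, then $\iota(G,\mathcal C)=\left\lfloor\frac{m+1}{5}\right\rfloor$. -/

import Mathlib

namespace Isolation

universe u

/-- The closed neighbourhood `N[D]` of a set `D` of vertices. -/
def closedNbhd {V : Type u} (G : SimpleGraph V) (D : Set V) : Set V :=
  {w | ∃ v ∈ D, w = v ∨ G.Adj v w}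

/-- A set of finite graphs. Only copies of the members matter below, so each finite graph is
represented by a graph on some `Fin n`. -/
abbrev GraphFamily : Type := Set (Σ n : ℕ, SimpleGraph (Fin n))

/-- The family of all cycles `C_n`, `n ≥ 3`. -/
def cycles : GraphFamily :=
  {F | ∃ n : ℕ, 3 ≤ n ∧ F = ⟨n, SimpleGraph.cycleGraph n⟩}

/-- `D` is an `F`-isolating set of `G`: the graph `G - N[D]` contains no copy (as a subgraph, not
necessarily induced) of a member of `F`. -/
def IsIsolating {V : Type u} (G : SimpleGraph V) (F : GraphFamily) (D : Finset V) : Prop :=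
  ∀ H ∈ F, ¬ H.2.IsContained (G.induce (closedNbhd G (D : Set V))ᶜ)

/-- The isolation number `ι(G, F)`: the smallest size of an `F`-isolating set. -/
noncomputable def isolationNumber {V : Type u} (G : SimpleGraph V) (F : GraphFamily) : ℕ :=
  sInf {n | ∃ D : Finset V, IsIsolating G F D ∧ D.card = n}

/-- In a finite graph some set is cycle-isolating, so the infimum defining
`isolationNumber G cycles` is a minimum. -/
theorem exists_isIsolating_cycles {V : Type u} [Finite V] (G : SimpleGraph V) :
    ∃ D : Finset V, IsIsolating G cycles D ∧ D.card = isolationNumber G cycles := by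
  classical
  have := Fintype.ofFinite V
  refine Nat.sInf_mem (s := {n | ∃ D : Finset V, IsIsolating G cycles D ∧ D.card = n})
    ⟨_, Finset.univ, ?_, rfl⟩
  rintro _ ⟨n, hn, rfl⟩ ⟨f⟩
  have h0 : 0 < n := by omega
  exact (f (⟨0, h0⟩ : Fin n)).2 ⟨_, by simp, Or.inl rfl⟩

/-- `t_k = (k choose 2) + 2`. -/
def constituentWeight (k : ℕ) : ℕ := k.choose 2 + 2

/-- The way in which `G` is assembled from a quotient tree on `v_1, …, v_q` (`q ≥ 1`), from `q`
clique constituents `G_i` and from an `r`-edge remainder tree. -/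
structure SpecialData {V : Type u} (G : SimpleGraph V) (k : ℕ) [NeZero k] (q r : ℕ) where
  /-- the `k`-clique connections `v_1, …, v_q` -/
  v : Fin q ↪ V
  /-- the elements `u_i^1, …, u_i^k` of `U_i`; here `u_i^1` is `u i 0` -/
  u : Fin q → Fin k ↪ V
  u_disjoint : ∀ i j, i ≠ j → Disjoint (Set.range (u i)) (Set.range (u j))
  u_ne_v : ∀ i j a, u i a ≠ v j
  /-- the quotient graph, a tree on (the indices of) `v_1, …, v_q` -/
  quotient : SimpleGraph (Fin q)
  quotient_isTree : quotient.IsTree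
  /-- the remainder graph -/
  remainder : G.Subgraph
  remainder_isTree : remainder.coe.IsTree
  remainder_card : remainder.edgeSet.ncard = r
  /-- the index of the connection at which the remainder graph is attached (it may be taken to
  be `q`, as the numbering of the connections is arbitrary) -/
  root : Fin q
  remainder_inter :
    remainder.verts ∩ ⋃ i, insert (v i) (Set.range (u i)) = {v root}
  verts_eq : remainder.verts ∪ ⋃ i, insert (v i) (Set.range (u i)) = Set.univ
  graph_eq : G = quotient.map v ⊔ remainder.spanningCoe ⊔
    ⨆ i, ((⊤ : SimpleGraph (Fin k)).map (u i) ⊔ SimpleGraph.edge (u i 0) (v i))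

/-- `(m,k)`-special graphs: write `m + 1 = q t_k + r` with `0 ≤ r < t_k`. If `q = 0`, these are
the trees with `m` edges; if `q ≥ 1`, they are assembled as in `SpecialData`. -/
def IsSpecial {V : Type u} (G : SimpleGraph V) (m k : ℕ) [NeZero k] : Prop :=
  ((m + 1) / constituentWeight k = 0 ∧ G.IsTree ∧ G.edgeSet.ncard = m) ∨
  (1 ≤ (m + 1) / constituentWeight k ∧
    Nonempty (SpecialData G k ((m + 1) / constituentWeight k) ((m + 1) % constituentWeight k)))

/-- Pure `(m,k)`-special graphs: those with `r = 0`. -/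
def IsPureSpecial {V : Type u} (G : SimpleGraph V) (m k : ℕ) [NeZero k] : Prop :=
  IsSpecial G m k ∧ (m + 1) % constituentWeight k = 0

end Isolation

/-! Edges are counted as ordered pairs: `dartCount G S S` is twice the number `m` of edges inside
`S`, so `5 * |D| ≤ m + 1` reads `10 * D.card ≤ dartCount G S S + 2`. By strong induction on
`S.card`, every connected `S` is `Classified`: it is a triangle, or has an isolating set with `5 *
|D| ≤ m`, or is pure special, or is a 4-cycle (`InducesConnected.classified`). This gives the bound
and the "only if" half of (i) at once.

If some bridge has no triangle on either side, the optimal sets of the two sides combine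
(`classified_union`): the bridge pays for the second `+ 1`. When both sides are extremal, an optimal
set on one side can contain the end of the bridge and dominate the other end, whose deletion saves a
vertex. The only exception is a bridge joining two connections, and then the union is again pure.

If every bridge cuts off a triangle and one exists (`classified_of_pendant_triangle`), the vertex at
which the triangle hangs is put into `D`. It breaks every triangle attached to it, and every other
component sends at least two edges to it, which pay for the component's `+ 1`.

If there is no bridge (`classified_of_bridgeless`), some `v` is put into `D` and each component of
`S - N[v]` is charged to its own edges and its at least two edges to `N[v]`. A triangle with a
further neighbour is handled by `hasSmallIsolating_of_triangle`, a triangle-free set with a vertex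
of degree at least 3 by `hasSmallIsolating_of_triangleFree`; what remains is a single vertex or a
cycle.

For the lower bound, an isolating set must meet each of the `q` disjoint constituents, because the
closed neighbourhood of the triangle in a constituent stays inside that constituent. -/

namespace Isolation

universe u

set_option linter.unusedSectionVars false

/-! ### Edge counting, forests, cuts and components -/

section Basic

variable {V : Type u} [DecidableEq V] (G : SimpleGraph V) [DecidableRel G.Adj]

/-- The number of pairs `(a, b) ∈ A × B` with `a` adjacent to `b`. -/
def dartCount (A B : Finset V) : ℕ := ∑ a ∈ A, ∑ b ∈ B, if G.Adj a b then 1 else 0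

/-- The vertices of `S` outside the closed neighbourhood of `D`. -/
def undominated (S D : Finset V) : Finset V := {w ∈ S | ∀ v ∈ D, w ≠ v ∧ ¬ G.Adj v w}

/-- `X` induces a forest: every nonempty subset spans fewer edges than it has vertices. -/
def InducesForest (X : Finset V) : Prop :=
  ∀ Y ⊆ X, Y.Nonempty → dartCount G Y Y + 2 ≤ 2 * Y.card

/-- `S` induces a connected graph, expressed by cuts. -/
def InducesConnected (S : Finset V) : Prop :=
  S.Nonempty ∧ ∀ A ⊆ S, A.Nonempty → (S \ A).Nonempty → 0 < dartCount G A (S \ A)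

/-- Every cut of the graph induced by `S` has at least two edges. -/
def Bridgeless (S : Finset V) : Prop :=
  ∀ A ⊆ S, A.Nonempty → (S \ A).Nonempty → 2 ≤ dartCount G A (S \ A)

/-- `C` is a connected component of the graph induced by `X`. -/
def IsComponent (X C : Finset V) : Prop :=
  C ⊆ X ∧ InducesConnected G C ∧ dartCount G C (X \ C) = 0

variable {G}

theorem dartCount_comm (A B : Finset V) : dartCount G A B = dartCount G B A := by
  unfold dartCount
  rw [Finset.sum_comm]
  simp only [G.adj_comm]

theorem dartCount_union_left {A B : Finset V} (h : Disjoint A B) (C : Finset V) :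
    dartCount G (A ∪ B) C = dartCount G A C + dartCount G B C :=
  Finset.sum_union h

theorem dartCount_union_right {A B : Finset V} (h : Disjoint A B) (C : Finset V) :
    dartCount G C (A ∪ B) = dartCount G C A + dartCount G C B := by
  rw [dartCount_comm, dartCount_union_left h, dartCount_comm A, dartCount_comm B]

theorem dartCount_union_self {A B : Finset V} (h : Disjoint A B) :
    dartCount G (A ∪ B) (A ∪ B) =
      dartCount G A A + dartCount G B B + 2 * dartCount G A B := by
  rw [dartCount_union_left h, dartCount_union_right h, dartCount_union_right h,
    dartCount_comm B A]
  ring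

theorem dartCount_split_self {A S : Finset V} (h : A ⊆ S) :
    dartCount G S S = dartCount G A A + dartCount G (S \ A) (S \ A)
      + 2 * dartCount G A (S \ A) := by
  conv_lhs => rw [← Finset.union_sdiff_of_subset h]
  exact dartCount_union_self Finset.disjoint_sdiff

theorem dartCount_split_right {A S : Finset V} (h : A ⊆ S) (C : Finset V) :
    dartCount G C S = dartCount G C A + dartCount G C (S \ A) := by
  conv_lhs => rw [← Finset.union_sdiff_of_subset h]
  exact dartCount_union_right Finset.disjoint_sdiff _

theorem dartCount_split_left {A S : Finset V} (h : A ⊆ S) (C : Finset V) :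
    dartCount G S C = dartCount G A C + dartCount G (S \ A) C := by
  conv_lhs => rw [← Finset.union_sdiff_of_subset h]
  exact dartCount_union_left Finset.disjoint_sdiff _

theorem dartCount_mono {A A' B B' : Finset V} (hA : A ⊆ A') (hB : B ⊆ B') :
    dartCount G A B ≤ dartCount G A' B' := by
  rw [dartCount_split_left hA, dartCount_split_right hB]
  omega

@[simp] theorem dartCount_empty_left (A : Finset V) : dartCount G ∅ A = 0 := by
  simp [dartCount]

@[simp] theorem dartCount_empty_right (A : Finset V) : dartCount G A ∅ = 0 := by
  simp [dartCount]

theorem dartCount_singleton (a b : V) :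
    dartCount G {a} {b} = if G.Adj a b then 1 else 0 := by
  rw [dartCount, Finset.sum_singleton, Finset.sum_singleton]

theorem dartCount_singleton_insert (a : V) {b : V} {B : Finset V} (h : b ∉ B) :
    dartCount G {a} (insert b B) = (if G.Adj a b then 1 else 0) + dartCount G {a} B := by
  rw [Finset.insert_eq, dartCount_union_right (by simpa using h), dartCount_singleton]

theorem dartCount_singleton_left (a : V) (B : Finset V) :
    dartCount G {a} B = {b ∈ B | G.Adj a b}.card := by
  rw [dartCount, Finset.sum_singleton, Finset.card_filter]

theorem dartCount_eq_sum (A B : Finset V) :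
    dartCount G A B = ∑ a ∈ A, dartCount G {a} B := by
  simp [dartCount]

theorem dartCount_eq_zero_iff {A B : Finset V} :
    dartCount G A B = 0 ↔ ∀ a ∈ A, ∀ b ∈ B, ¬ G.Adj a b := by
  simp [dartCount]

theorem dartCount_pos_iff {A B : Finset V} :
    0 < dartCount G A B ↔ ∃ a ∈ A, ∃ b ∈ B, G.Adj a b := by
  rw [Nat.pos_iff_ne_zero, Ne, dartCount_eq_zero_iff]
  push Not
  rfl

theorem dartCount_eq_card (A B : Finset V) :
    dartCount G A B = {p ∈ A ×ˢ B | G.Adj p.1 p.2}.card := by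
  rw [Finset.card_filter, Finset.sum_product, dartCount]

/-- A single cross edge is the only one. -/
theorem eq_of_dartCount_eq_one {A B : Finset V} (h : dartCount G A B = 1) {a a' b b' : V}
    (ha : a ∈ A) (hb : b ∈ B) (hab : G.Adj a b) (ha' : a' ∈ A) (hb' : b' ∈ B)
    (hab' : G.Adj a' b') : a' = a ∧ b' = b := by
  rw [dartCount_eq_card, Finset.card_eq_one] at h
  obtain ⟨p, hp⟩ := h
  have h1 : (a, b) ∈ ({p} : Finset (V × V)) := by rw [← hp]; simp [ha, hb, hab]
  have h2 : (a', b') ∈ ({p} : Finset (V × V)) := by rw [← hp]; simp [ha', hb', hab']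
  rw [Finset.mem_singleton] at h1 h2
  have := h2.trans h1.symm
  exact Prod.mk.inj this

/-- Listing distinct cross edges bounds the number of cross edges from below. -/
theorem card_le_dartCount {A B : Finset V} (P : Finset (V × V))
    (h : ∀ p ∈ P, p.1 ∈ A ∧ p.2 ∈ B ∧ G.Adj p.1 p.2) : P.card ≤ dartCount G A B := by
  rw [dartCount_eq_card]
  refine Finset.card_le_card fun p hp => ?_
  obtain ⟨h1, h2, h3⟩ := h p hp
  simp [h1, h2, h3]

@[simp] theorem dartCount_singleton_self (a : V) : dartCount G {a} {a} = 0 := by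
  simp [dartCount]

theorem dartCount_insert_self {a : V} {A : Finset V} (h : a ∉ A) :
    dartCount G (insert a A) (insert a A) = dartCount G A A + 2 * dartCount G {a} A := by
  rw [Finset.insert_eq, dartCount_union_self (by simpa using h)]
  simp

theorem even_dartCount_self (A : Finset V) : Even (dartCount G A A) := by
  induction A using Finset.induction_on with
  | empty => simp
  | insert a A h ih => rw [dartCount_insert_self h]; exact ih.add (even_two_mul _)

/-! ### Forests -/

theorem InducesForest.mono {X Y : Finset V} (h : InducesForest G Y) (hXY : X ⊆ Y) :
    InducesForest G X :=
  fun Z hZ => h Z (hZ.trans hXY)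

theorem InducesForest.union {X Y : Finset V} (hX : InducesForest G X) (hY : InducesForest G Y)
    (hd : Disjoint X Y) (h : dartCount G X Y ≤ 1) : InducesForest G (X ∪ Y) := by
  intro Z hZ hne
  have hZe : Z = (Z ∩ X) ∪ (Z ∩ Y) := by
    rw [← Finset.inter_union_distrib_left, Finset.inter_eq_left.mpr hZ]
  have hdis : Disjoint (Z ∩ X) (Z ∩ Y) :=
    hd.mono Finset.inter_subset_right Finset.inter_subset_right
  have hle : dartCount G (Z ∩ X) (Z ∩ Y) ≤ 1 :=
    (dartCount_mono Finset.inter_subset_right Finset.inter_subset_right).trans h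
  have h1 := hX (Z ∩ X) Finset.inter_subset_right
  have h2 := hY (Z ∩ Y) Finset.inter_subset_right
  have hc : Z.card = (Z ∩ X).card + (Z ∩ Y).card := by
    conv_lhs => rw [hZe]
    exact Finset.card_union_of_disjoint hdis
  have he : dartCount G Z Z = dartCount G (Z ∩ X) (Z ∩ X) + dartCount G (Z ∩ Y) (Z ∩ Y)
      + 2 * dartCount G (Z ∩ X) (Z ∩ Y) := by
    conv_lhs => rw [hZe]
    exact dartCount_union_self hdis
  rcases (Z ∩ X).eq_empty_or_nonempty with e1 | n1
  · rcases (Z ∩ Y).eq_empty_or_nonempty with e2 | n2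
    · rw [hZe, e1, e2] at hne; simp at hne
    · have := h2 n2; rw [e1] at he hc; simp at he hc; omega
  · rcases (Z ∩ Y).eq_empty_or_nonempty with e2 | n2
    · have := h1 n1; rw [e2] at he hc; simp at he hc; omega
    · have := h1 n1; have := h2 n2; omega

theorem inducesForest_of_card_le_two {X : Finset V} (h : X.card ≤ 2) : InducesForest G X := by
  intro Y hY hne
  have h1 := (Finset.card_le_card hY).trans h
  have h2 := hne.card_pos
  obtain h3 | h3 : Y.card = 1 ∨ Y.card = 2 := by omega
  · obtain ⟨a, rfl⟩ := Finset.card_eq_one.mp h3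
    simp
  · obtain ⟨a, b, hab, rfl⟩ := Finset.card_eq_two.mp h3
    rw [dartCount_insert_self (by simpa using hab), dartCount_singleton_self,
      dartCount_singleton, Finset.card_pair hab]
    split_ifs <;> omega

theorem inducesForest_empty : InducesForest G ∅ := inducesForest_of_card_le_two (by simp)

/-! ### Undominated vertices -/

theorem mem_undominated {S D : Finset V} {w : V} :
    w ∈ undominated G S D ↔ w ∈ S ∧ ∀ v ∈ D, w ≠ v ∧ ¬ G.Adj v w := by
  simp [undominated]

theorem undominated_subset (S D : Finset V) : undominated G S D ⊆ S := Finset.filter_subset _ _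

theorem undominated_mono {S S' D D' : Finset V} (hS : S ⊆ S') (hD : D' ⊆ D) :
    undominated G S D ⊆ undominated G S' D' := by
  intro w
  simp only [mem_undominated]
  exact fun h => ⟨hS h.1, fun v hv => h.2 v (hD hv)⟩

theorem undominated_union (S T D : Finset V) :
    undominated G (S ∪ T) D = undominated G S D ∪ undominated G T D :=
  Finset.filter_union _ _ _

theorem undominated_union_subset (S T D D' : Finset V) :
    undominated G (S ∪ T) (D ∪ D') ⊆ undominated G S D ∪ undominated G T D' := by
  rw [undominated_union]
  exact Finset.union_subset_union (undominated_mono le_rfl Finset.subset_union_left)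
    (undominated_mono le_rfl Finset.subset_union_right)

theorem InducesForest.undominated_union {S T D D' : Finset V}
    (h : InducesForest G (undominated G S D)) (h' : InducesForest G (undominated G T D'))
    (hd : Disjoint S T) (hc : dartCount G S T ≤ 1) :
    InducesForest G (undominated G (S ∪ T) (D ∪ D')) :=
  (h.union h' (hd.mono (undominated_subset _ _) (undominated_subset _ _))
    ((dartCount_mono (undominated_subset _ _) (undominated_subset _ _)).trans hc)).mono
    (undominated_union_subset _ _ _ _)

/-! ### Connectivity and components -/

/-- If `A` split into two parts with no edge between them, the single edge leaving `A` would start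
in only one part, and the other part would be cut off from the rest of `S`. -/
theorem inducesConnected_of_dartCount_eq_one {S A : Finset V} (hS : InducesConnected G S)
    (hA : A ⊆ S) (hne : A.Nonempty) (h : dartCount G A (S \ A) = 1) : InducesConnected G A := by
  refine ⟨hne, fun B hB hBne hAB => ?_⟩
  by_contra h0
  have h0 : dartCount G B (A \ B) = 0 := by omega
  have hSA : (S \ A).Nonempty := by
    rw [Finset.nonempty_iff_ne_empty]; intro h1; rw [h1] at h; simp at h
  have h1 := hS.2 B (hB.trans hA) hBne (hAB.mono (Finset.sdiff_subset_sdiff hA le_rfl))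
  have h2 := hS.2 (A \ B) (Finset.sdiff_subset.trans hA) hAB
    (hSA.mono (Finset.sdiff_subset_sdiff le_rfl Finset.sdiff_subset))
  have e1 : S \ B = (A \ B) ∪ (S \ A) := by
    ext x; have := @hB x; have := @hA x; simp; tauto
  have e2 : S \ (A \ B) = B ∪ (S \ A) := by
    ext x; have := @hB x; have := @hA x; simp; tauto
  have d1 : Disjoint (A \ B) (S \ A) := Finset.disjoint_sdiff.mono_left Finset.sdiff_subset
  have d2 : Disjoint B (S \ A) := Finset.disjoint_sdiff.mono_left hB
  rw [e1, dartCount_union_right d1] at h1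
  rw [e2, dartCount_union_right d2, dartCount_comm (A \ B) B] at h2
  rw [dartCount_split_left hB] at h
  omega

/-- The component is a smallest subset containing `a` that no edge leaves. An empty cut inside it
would yield a smaller such set, namely the side containing `a`. -/
theorem exists_isComponent_mem {X : Finset V} {a : V} (ha : a ∈ X) :
    ∃ C, IsComponent G X C ∧ a ∈ C := by
  obtain ⟨C, hC, hmin⟩ := Finset.exists_min_image
    {C ∈ X.powerset | a ∈ C ∧ dartCount G C (X \ C) = 0} Finset.card ⟨X, by simp [ha]⟩
  simp only [Finset.mem_filter, Finset.mem_powerset] at hC hmin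
  obtain ⟨hCX, haC, h0⟩ := hC
  have key : ∀ A ⊆ C, a ∈ A → (C \ A).Nonempty → 0 < dartCount G A (C \ A) := by
    intro A hA haA hne
    by_contra h
    have h : dartCount G A (C \ A) = 0 := by omega
    have e : X \ A = (C \ A) ∪ (X \ C) := by
      ext x; have := @hA x; have := @hCX x; simp; tauto
    have := hmin A ⟨hA.trans hCX, haA, by
      rw [e, dartCount_union_right (Finset.disjoint_sdiff.mono_left Finset.sdiff_subset), h]
      have := dartCount_mono (G := G) hA (le_refl (X \ C))
      omega⟩
    have h2 := Finset.card_sdiff_add_card_eq_card hA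
    have := hne.card_pos
    omega
  refine ⟨C, ⟨hCX, ⟨⟨a, haC⟩, fun A hA hAne hne => ?_⟩, h0⟩, haC⟩
  by_cases haA : a ∈ A
  · exact key A hA haA hne
  · have := key (C \ A) Finset.sdiff_subset (by simp [haC, haA])
      (by rwa [Finset.sdiff_sdiff_eq_self hA])
    rwa [Finset.sdiff_sdiff_eq_self hA, dartCount_comm] at this

theorem IsComponent.subset_of_isClosed {X C K : Finset V} (hC : IsComponent G X C)
    (hK : dartCount G K (X \ K) = 0) (h : (C ∩ K).Nonempty) : C ⊆ K := by
  by_contra hn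
  have h1 := hC.2.1.2 (C ∩ K) Finset.inter_subset_left h
    (by rwa [Finset.sdiff_inter_self_left, Finset.sdiff_nonempty])
  have h2 := dartCount_mono (G := G) (A := C ∩ K) (B := C \ (C ∩ K)) Finset.inter_subset_right
    (show C \ (C ∩ K) ⊆ X \ K by
      rw [Finset.sdiff_inter_self_left]; exact Finset.sdiff_subset_sdiff hC.1 le_rfl)
  omega

theorem IsComponent.of_sdiff {X C C' : Finset V} (hC : IsComponent G X C)
    (h : IsComponent G (X \ C) C') : IsComponent G X C' := by
  have hd : Disjoint C' C := Finset.disjoint_of_subset_left h.1 Finset.sdiff_disjoint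
  refine ⟨h.1.trans Finset.sdiff_subset, h.2.1, ?_⟩
  have e : X \ C' = ((X \ C) \ C') ∪ C := by
    ext x; have := @hC.1 x
    have h3 : x ∈ C' → x ∉ C := fun h4 => Finset.disjoint_left.mp hd h4
    simp; tauto
  rw [e, dartCount_union_right (Finset.sdiff_disjoint.mono_left Finset.sdiff_subset), h.2.2,
    dartCount_comm]
  have := dartCount_mono (G := G) (le_refl C) h.1
  have := hC.2.2
  omega

/-- Isolating sets of the components combine to an isolating set of the whole. -/
theorem exists_isolating_of_components (N R : Finset V) (k : ℕ) (X : Finset V)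
    (h : ∀ C, IsComponent G X C → ∃ D, InducesForest G (undominated G (C \ N) D) ∧
      10 * D.card ≤ dartCount G C C + k * dartCount G C R) :
    ∃ D, InducesForest G (undominated G (X \ N) D) ∧
      10 * D.card ≤ dartCount G X X + k * dartCount G X R := by
  induction hn : X.card using Nat.strong_induction_on generalizing X with
  | _ n ih =>
    rcases X.eq_empty_or_nonempty with rfl | ⟨a, ha⟩
    · exact ⟨∅, inducesForest_empty.mono ((undominated_subset _ _).trans (by simp)), by simp⟩
    -- Components are peeled off one at a time. No edges run between them, so both the edge counts
    -- and the charges `k * dartCount G C R` add up exactly.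
    obtain ⟨C, hC, haC⟩ := exists_isComponent_mem (G := G) ha
    obtain ⟨D, hD, hDc⟩ := h C hC
    have hcard := Finset.card_sdiff_add_card_eq_card hC.1
    have : 0 < C.card := Finset.card_pos.mpr ⟨a, haC⟩
    obtain ⟨D', hD', hDc'⟩ := ih (X \ C).card (by omega) (X \ C)
      (fun C' hC' => h C' (hC.of_sdiff hC')) rfl
    refine ⟨D ∪ D', ?_, ?_⟩
    · have e : X \ N = (C \ N) ∪ ((X \ C) \ N) := by
        rw [← Finset.union_sdiff_distrib, Finset.union_sdiff_of_subset hC.1]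
      rw [e]
      refine hD.undominated_union hD' (Finset.disjoint_sdiff.mono Finset.sdiff_subset
        Finset.sdiff_subset) ?_
      have := dartCount_mono (G := G) (Finset.sdiff_subset (s := C) (t := N))
        (Finset.sdiff_subset (s := X \ C) (t := N))
      have := hC.2.2
      omega
    · have h1 := Finset.card_union_le D D'
      have h2 := dartCount_split_self (G := G) hC.1
      have h3 := dartCount_split_left (G := G) hC.1 R
      have h4 := hC.2.2
      rw [h2, h3, h4, mul_add]
      omega

/-- As `exists_isolating_of_components`, with extra slack coming from one component. -/
theorem exists_isolating_of_components_of_slack (N R : Finset V) (k s : ℕ) (X C₀ : Finset V)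
    (hC₀ : IsComponent G X C₀)
    (h₀ : ∃ D, InducesForest G (undominated G (C₀ \ N) D) ∧
      10 * D.card + s ≤ dartCount G C₀ C₀ + k * dartCount G C₀ R)
    (h : ∀ C, IsComponent G (X \ C₀) C → ∃ D, InducesForest G (undominated G (C \ N) D) ∧
      10 * D.card ≤ dartCount G C C + k * dartCount G C R) :
    ∃ D, InducesForest G (undominated G (X \ N) D) ∧
      10 * D.card + s ≤ dartCount G X X + k * dartCount G X R := by
  obtain ⟨D, hD, hDc⟩ := h₀
  obtain ⟨D', hD', hDc'⟩ := exists_isolating_of_components N R k (X \ C₀) h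
  refine ⟨D ∪ D', ?_, ?_⟩
  · have e : X \ N = (C₀ \ N) ∪ ((X \ C₀) \ N) := by
      rw [← Finset.union_sdiff_distrib, Finset.union_sdiff_of_subset hC₀.1]
    rw [e]
    refine hD.undominated_union hD' (Finset.disjoint_sdiff.mono Finset.sdiff_subset
      Finset.sdiff_subset) ?_
    have := dartCount_mono (G := G) (Finset.sdiff_subset (s := C₀) (t := N))
      (Finset.sdiff_subset (s := X \ C₀) (t := N))
    have := hC₀.2.2
    omega
  · have h1 := Finset.card_union_le D D'
    have h2 := dartCount_split_self (G := G) hC₀.1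
    have h3 := dartCount_split_left (G := G) hC₀.1 R
    have h4 := hC₀.2.2
    rw [h2, h3, h4, mul_add]
    omega

end Basic

/-! ### Extremal graphs and gluing along a bridge -/

section Extremal

variable {V : Type u} [DecidableEq V] (G : SimpleGraph V) [DecidableRel G.Adj]

/-- `S` has an isolating set of size at most `m / 5`, with `m` the number of edges inside `S`. -/
def HasSmallIsolating (S : Finset V) : Prop :=
  ∃ D, InducesForest G (undominated G S D) ∧ 10 * D.card ≤ dartCount G S S

/-- `S` induces a pure special graph with set of connections `W`. -/
inductive InducesPure : Finset V → Finset V → Prop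
  | single {T : Finset V} {b : V} : G.IsNClique 3 T → b ∉ T → dartCount G T {b} = 1 →
      InducesPure (insert b T) {b}
  | join {S₁ W₁ S₂ W₂ : Finset V} {a b : V} : InducesPure S₁ W₁ → InducesPure S₂ W₂ →
      Disjoint S₁ S₂ → dartCount G S₁ S₂ = 1 → a ∈ W₁ → b ∈ W₂ → G.Adj a b →
      InducesPure (S₁ ∪ S₂) (W₁ ∪ W₂)

/-- `S` induces a `4`-cycle. -/
def InducesSquare (S : Finset V) : Prop :=
  S.card = 4 ∧ (∀ v ∈ S, dartCount G {v} S = 2) ∧ ∀ v ∈ S, InducesForest G (S.erase v)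

/-- The alternatives for a connected vertex set. -/
def Classified (S : Finset V) : Prop :=
  G.IsNClique 3 S ∨ HasSmallIsolating G S ∨ (∃ W, InducesPure G S W) ∨ InducesSquare G S

variable {G}

theorem dartCount_of_isNClique_three {T : Finset V} (h : G.IsNClique 3 T) :
    dartCount G T T = 6 := by
  obtain ⟨a, b, c, hab, hac, hbc, rfl⟩ := SimpleGraph.is3Clique_iff.mp h
  have h1 := hab.ne
  have h2 := hac.ne
  have h3 := hbc.ne
  rw [dartCount_insert_self (by simp [h1, h2]), dartCount_insert_self (by simp [h3]),
    dartCount_singleton_insert _ (by simp [h3])]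
  simp only [dartCount_singleton, hab, hac, hbc, if_pos, SimpleGraph.irrefl, if_false]

theorem InducesPure.subset {S W : Finset V} (h : InducesPure G S W) : W ⊆ S := by
  induction h with
  | single => simp
  | join _ _ _ _ _ _ _ ih₁ ih₂ => exact Finset.union_subset_union ih₁ ih₂

/-- Every vertex of an extremal graph lies in an optimal isolating set. -/
theorem InducesPure.exists_mem_isolating {S W : Finset V} (h : InducesPure G S W) :
    ∀ a ∈ S, ∃ D, a ∈ D ∧ InducesForest G (undominated G S D) ∧
      10 * D.card ≤ dartCount G S S + 2 := by
  induction h with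
  | @single T b hT hb h1 =>
    intro a ha
    -- One vertex suffices: the connection leaves at most two triangle vertices undominated, and a
    -- triangle vertex leaves at most the connection. The constituent has 4 edges, and `10 = 8 + 2`.
    refine ⟨{a}, by simp, ?_, ?_⟩
    · apply inducesForest_of_card_le_two
      rcases Finset.mem_insert.mp ha with rfl | haT
      · obtain ⟨t, ht, c, hc, htc⟩ := dartCount_pos_iff.mp (h1 ▸ Nat.one_pos)
        rw [Finset.mem_singleton] at hc
        subst hc
        have : undominated G (insert c T) {c} ⊆ T.erase t := by
          intro w
          simp only [mem_undominated, Finset.mem_insert, Finset.mem_singleton, forall_eq,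
            Finset.mem_erase]
          rintro ⟨hw, h2, h3⟩
          refine ⟨?_, by tauto⟩
          rintro rfl
          exact h3 htc.symm
        refine (Finset.card_le_card this).trans ?_
        rw [Finset.card_erase_of_mem ht, hT.card_eq]
      · have : undominated G (insert b T) {a} ⊆ {b} := by
          intro w
          simp only [mem_undominated, Finset.mem_insert, Finset.mem_singleton, forall_eq]
          rintro ⟨hw | hw, h2, h3⟩
          · exact hw
          · exact absurd (hT.isClique haT hw (Ne.symm h2)) h3
        exact (Finset.card_le_card this).trans (by simp)
    · rw [dartCount_insert_self hb, dartCount_of_isNClique_three hT, dartCount_comm, h1]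
      simp
  | @join S₁ W₁ S₂ W₂ a b p₁ p₂ hd h1 ha hb hab ih₁ ih₂ =>
    have hc := dartCount_union_self (G := G) hd
    have key : ∀ c₁ ∈ S₁, ∀ c₂ ∈ S₂, ∃ D, c₁ ∈ D ∧ c₂ ∈ D ∧
        InducesForest G (undominated G (S₁ ∪ S₂) D) ∧
        10 * D.card ≤ dartCount G (S₁ ∪ S₂) (S₁ ∪ S₂) + 2 := by
      intro c₁ h₁ c₂ h₂
      obtain ⟨D₁, m₁, f₁, e₁⟩ := ih₁ c₁ h₁
      obtain ⟨D₂, m₂, f₂, e₂⟩ := ih₂ c₂ h₂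
      refine ⟨D₁ ∪ D₂, by simp [m₁], by simp [m₂], f₁.undominated_union f₂ hd h1.le, ?_⟩
      have := Finset.card_union_le D₁ D₂
      omega
    intro c hcm
    rcases Finset.mem_union.mp hcm with hcm | hcm
    · obtain ⟨D, h, -, h'⟩ := key c hcm b (p₂.subset hb)
      exact ⟨D, h, h'⟩
    · obtain ⟨D, -, h, h'⟩ := key a (p₁.subset ha) c hcm
      exact ⟨D, h, h'⟩

/-- Removing a vertex that is not a connection saves one vertex of an isolating set. -/
theorem InducesPure.exists_isolating_erase {S W : Finset V} (h : InducesPure G S W) :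
    ∀ a ∈ S, a ∉ W → ∃ D, InducesForest G (undominated G (S.erase a) D) ∧
      10 * D.card + 8 ≤ dartCount G S S := by
  induction h with
  | @single T b hT hb h1 =>
    intro a ha haW
    rw [Finset.mem_singleton] at haW
    have haT : a ∈ T := by simpa [haW] using ha
    refine ⟨∅, ?_, ?_⟩
    · refine InducesForest.mono ?_ (undominated_subset _ _)
      have e : (insert b T).erase a = T.erase a ∪ {b} := by
        ext x; simp; constructor
        · tauto
        · rintro (rfl | h)
          · exact ⟨Ne.symm haW, Or.inl rfl⟩
          · tauto
      rw [e]
      refine (inducesForest_of_card_le_two ?_).union (inducesForest_of_card_le_two (by simp))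
        (by simp [hb]) ?_
      · rw [Finset.card_erase_of_mem haT, hT.card_eq]
      · exact (dartCount_mono (Finset.erase_subset _ _) le_rfl).trans h1.le
    · rw [dartCount_insert_self hb, dartCount_of_isNClique_three hT, dartCount_comm, h1]
      simp
  | @join S₁ W₁ S₂ W₂ a b p₁ p₂ hd h1 ha hb hab ih₁ ih₂ =>
    have hc := dartCount_union_self (G := G) hd
    intro c hcm hcW
    rw [Finset.mem_union, not_or] at hcW
    rcases Finset.mem_union.mp hcm with hcm | hcm
    · obtain ⟨D₁, f₁, e₁⟩ := ih₁ c hcm hcW.1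
      obtain ⟨D₂, -, f₂, e₂⟩ := p₂.exists_mem_isolating b (p₂.subset hb)
      have e : (S₁ ∪ S₂).erase c = S₁.erase c ∪ S₂ := by
        rw [Finset.erase_union_distrib,
          Finset.erase_eq_of_notMem (Finset.disjoint_left.mp hd hcm)]
      refine ⟨D₁ ∪ D₂, ?_, ?_⟩
      · rw [e]
        exact f₁.undominated_union f₂ (hd.mono_left (Finset.erase_subset _ _))
          ((dartCount_mono (Finset.erase_subset _ _) le_rfl).trans h1.le)
      · have := Finset.card_union_le D₁ D₂
        omega
    · obtain ⟨D₂, f₂, e₂⟩ := ih₂ c hcm hcW.2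
      obtain ⟨D₁, -, f₁, e₁⟩ := p₁.exists_mem_isolating a (p₁.subset ha)
      have e : (S₁ ∪ S₂).erase c = S₁ ∪ S₂.erase c := by
        rw [Finset.erase_union_distrib,
          Finset.erase_eq_of_notMem (Finset.disjoint_right.mp hd hcm)]
      refine ⟨D₁ ∪ D₂, ?_, ?_⟩
      · rw [e]
        exact f₁.undominated_union f₂ (hd.mono_right (Finset.erase_subset _ _))
          ((dartCount_mono le_rfl (Finset.erase_subset _ _)).trans h1.le)
      · have := Finset.card_union_le D₁ D₂
        omega

theorem InducesSquare.dartCount_self {S : Finset V} (h : InducesSquare G S) :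
    dartCount G S S = 8 := by
  rw [dartCount_eq_sum, Finset.sum_congr rfl h.2.1, Finset.sum_const, h.1, smul_eq_mul]

theorem InducesSquare.exists_mem_isolating {S : Finset V} (h : InducesSquare G S) (a : V)
    (ha : a ∈ S) : ∃ D, a ∈ D ∧ InducesForest G (undominated G S D) ∧
      10 * D.card ≤ dartCount G S S + 2 := by
  refine ⟨{a}, by simp, (h.2.2 a ha).mono ?_, by rw [h.dartCount_self]; simp⟩
  intro w
  simp only [mem_undominated, Finset.mem_singleton, forall_eq, Finset.mem_erase]
  tauto

theorem InducesSquare.exists_isolating_erase {S : Finset V} (h : InducesSquare G S) (a : V)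
    (ha : a ∈ S) : ∃ D, InducesForest G (undominated G (S.erase a) D) ∧
      10 * D.card + 8 ≤ dartCount G S S :=
  ⟨∅, (h.2.2 a ha).mono (undominated_subset _ _), by rw [h.dartCount_self]; simp⟩

/-- The triangle is the only alternative that violates the bound: it needs one vertex for 3 edges.
-/
theorem Classified.exists_isolating {S : Finset V} (h : Classified G S)
    (hS : InducesConnected G S) (hT : ¬ G.IsNClique 3 S) :
    ∃ D, InducesForest G (undominated G S D) ∧ 10 * D.card ≤ dartCount G S S + 2 := by
  obtain ⟨a, ha⟩ := hS.1
  rcases h with h | ⟨D, hD, hc⟩ | ⟨W, hW⟩ | h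
  · exact absurd h hT
  · exact ⟨D, hD, by omega⟩
  · obtain ⟨D, -, h⟩ := hW.exists_mem_isolating a ha
    exact ⟨D, h⟩
  · obtain ⟨D, -, h⟩ := h.exists_mem_isolating a ha
    exact ⟨D, h⟩

/-- Since `a ∈ DA` dominates `b`, only `B.erase b` has to be isolated on the other side. -/
theorem hasSmallIsolating_of_erase {A B DA DB : Finset V} {a b : V} (hd : Disjoint A B)
    (h1 : dartCount G A B = 1) (hab : G.Adj a b) (haD : a ∈ DA)
    (fA : InducesForest G (undominated G A DA)) (eA : 10 * DA.card ≤ dartCount G A A + 2)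
    (fB : InducesForest G (undominated G (B.erase b) DB))
    (eB : 10 * DB.card + 8 ≤ dartCount G B B) : HasSmallIsolating G (A ∪ B) := by
  refine ⟨DA ∪ DB, ?_, ?_⟩
  · refine (fA.undominated_union fB (hd.mono_right (Finset.erase_subset _ _))
      ((dartCount_mono le_rfl (Finset.erase_subset _ _)).trans h1.le)).mono ?_
    intro w
    simp only [mem_undominated, Finset.mem_union, Finset.mem_erase]
    rintro ⟨hw, h2⟩
    refine ⟨?_, h2⟩
    have : w ≠ b := by
      rintro rfl
      exact (h2 a (Or.inl haD)).2 hab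
    tauto
  · have := Finset.card_union_le DA DB
    have := dartCount_union_self (G := G) hd
    omega

/-- Two classified sets joined by a single edge, neither of them a triangle. -/
theorem classified_union {A B : Finset V} (hd : Disjoint A B) (h1 : dartCount G A B = 1)
    (hA : InducesConnected G A) (hB : InducesConnected G B) (tA : ¬ G.IsNClique 3 A)
    (tB : ¬ G.IsNClique 3 B) (cA : Classified G A) (cB : Classified G B) :
    Classified G (A ∪ B) := by
  have hc := dartCount_union_self (G := G) hd
  obtain ⟨DA, fA, eA⟩ := cA.exists_isolating hA tA
  obtain ⟨DB, fB, eB⟩ := cB.exists_isolating hB tB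
  obtain ⟨a, ha, b, hb, hab⟩ := dartCount_pos_iff.mp (h1 ▸ Nat.one_pos)
  have h1' : dartCount G B A = 1 := by rw [dartCount_comm, h1]
  have saveB : (∃ DA, a ∈ DA ∧ InducesForest G (undominated G A DA) ∧
      10 * DA.card ≤ dartCount G A A + 2) → (∃ DB, InducesForest G (undominated G (B.erase b) DB) ∧
      10 * DB.card + 8 ≤ dartCount G B B) → Classified G (A ∪ B) := by
    rintro ⟨DA, haD, fA, eA⟩ ⟨DB, fB, eB⟩
    exact Or.inr (Or.inl (hasSmallIsolating_of_erase hd h1 hab haD fA eA fB eB))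
  have saveA : (∃ DB, b ∈ DB ∧ InducesForest G (undominated G B DB) ∧
      10 * DB.card ≤ dartCount G B B + 2) → (∃ DA, InducesForest G (undominated G (A.erase a) DA) ∧
      10 * DA.card + 8 ≤ dartCount G A A) → Classified G (A ∪ B) := by
    rintro ⟨DB, hbD, fB, eB⟩ ⟨DA, fA, eA⟩
    rw [Finset.union_comm]
    exact Or.inr (Or.inl (hasSmallIsolating_of_erase hd.symm h1' hab.symm hbD fB eB fA eA))
  rcases cA with h | ⟨D, f, e⟩ | ⟨W, hW⟩ | h
  · exact absurd h tA
  · refine Or.inr (Or.inl ⟨D ∪ DB, f.undominated_union fB hd h1.le, ?_⟩)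
    have := Finset.card_union_le D DB
    omega
  · rcases cB with h' | ⟨D, f, e⟩ | ⟨W', hW'⟩ | h'
    · exact absurd h' tB
    · refine Or.inr (Or.inl ⟨DA ∪ D, fA.undominated_union f hd h1.le, ?_⟩)
      have := Finset.card_union_le DA D
      omega
    · by_cases haW : a ∈ W
      · by_cases hbW : b ∈ W'
        -- Both ends of the bridge are connections: the only case in which no vertex can be saved.
        · exact Or.inr (Or.inr (Or.inl ⟨_, hW.join hW' hd h1 haW hbW hab⟩))
        · exact saveB (hW.exists_mem_isolating a ha) (hW'.exists_isolating_erase b hb hbW)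
      · exact saveA (hW'.exists_mem_isolating b hb) (hW.exists_isolating_erase a ha haW)
    · exact saveB (hW.exists_mem_isolating a ha) (h'.exists_isolating_erase b hb)
  · rcases cB with h' | ⟨D, f, e⟩ | ⟨W', hW'⟩ | h'
    · exact absurd h' tB
    · refine Or.inr (Or.inl ⟨DA ∪ D, fA.undominated_union f hd h1.le, ?_⟩)
      have := Finset.card_union_le DA D
      omega
    · exact saveA (hW'.exists_mem_isolating b hb) (h.exists_isolating_erase a ha)
    · exact saveB (h.exists_mem_isolating a ha) (h'.exists_isolating_erase b hb)

end Extremal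

/-! ### Bridgeless sets, pendant triangles and the induction -/

section Hub

variable {V : Type u} [DecidableEq V] (G : SimpleGraph V) [DecidableRel G.Adj]

/-- The closed neighbourhood of `v` inside `S` (for `v ∈ S`). -/
def closedStar (S : Finset V) (v : V) : Finset V := insert v {w ∈ S | G.Adj v w}

variable {G}

theorem mem_closedStar {S : Finset V} {v w : V} :
    w ∈ closedStar G S v ↔ w = v ∨ (w ∈ S ∧ G.Adj v w) := by
  simp [closedStar]

theorem closedStar_subset {S : Finset V} {v : V} (hv : v ∈ S) : closedStar G S v ⊆ S := by
  intro w hw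
  rcases mem_closedStar.mp hw with rfl | h
  · exact hv
  · exact h.1

theorem undominated_insert_subset (S D : Finset V) (v : V) :
    undominated G S (insert v D) ⊆ undominated G (S \ closedStar G S v) D := by
  intro w
  simp only [mem_undominated, Finset.mem_insert, Finset.mem_sdiff, mem_closedStar]
  rintro ⟨h1, h2⟩
  have := h2 v (Or.inl rfl)
  exact ⟨⟨h1, by tauto⟩, fun u hu => h2 u (Or.inr hu)⟩

theorem IsComponent.dartCount_compl {S R C : Finset V} (hR : R ⊆ S)
    (hC : IsComponent G (S \ R) C) : dartCount G C (S \ C) = dartCount G C R := by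
  have hRC : R ⊆ S \ C := by
    intro x hx
    rw [Finset.mem_sdiff]
    exact ⟨hR hx, fun h => (Finset.mem_sdiff.mp (hC.1 h)).2 hx⟩
  have e : (S \ C) \ R = (S \ R) \ C := sdiff_right_comm _ _ _
  rw [dartCount_split_right hRC, e, hC.2.2, add_zero]

theorem IsComponent.sdiff_nonempty {S R C : Finset V} (hR : R ⊆ S) (hne : R.Nonempty)
    (hC : IsComponent G (S \ R) C) : (S \ C).Nonempty := by
  obtain ⟨r, hr⟩ := hne
  exact ⟨r, Finset.mem_sdiff.mpr ⟨hR hr, fun h => (Finset.mem_sdiff.mp (hC.1 h)).2 hr⟩⟩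

theorem IsComponent.mem_of_adj {X C : Finset V} (hC : IsComponent G X C) {a b : V} (ha : a ∈ C)
    (hb : b ∈ X) (hab : G.Adj a b) : b ∈ C := by
  by_contra h
  exact dartCount_eq_zero_iff.mp hC.2.2 a ha b (Finset.mem_sdiff.mpr ⟨hb, h⟩) hab

/-- A triangle overspends by 4, which is what two edges leaving it contribute when each is counted
twice. -/
theorem exists_isolating_isNClique_three {T : Finset V} (hT : G.IsNClique 3 T) :
    ∃ D, InducesForest G (undominated G T D) ∧ 10 * D.card = dartCount G T T + 4 := by
  obtain ⟨t, ht⟩ : T.Nonempty := by rw [← Finset.card_pos, hT.card_eq]; norm_num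
  refine ⟨{t}, inducesForest_empty.mono ?_, by rw [dartCount_of_isNClique_three hT]; simp⟩
  intro w
  simp only [mem_undominated, Finset.mem_singleton, forall_eq]
  rintro ⟨hw, h1, h2⟩
  exact absurd (hT.isClique ht hw (Ne.symm h1)) h2

/-- A vertex whose closed neighbourhood spans many edges. -/
theorem hasSmallIsolating_of_closedStar {S X : Finset V} {v : V} (hv : v ∈ S)
    (hX : X = S \ closedStar G S v)
    (s : ℕ)
    (hs : 10 ≤ dartCount G (closedStar G S v) (closedStar G S v) + s)
    (h : ∃ D, InducesForest G (undominated G (X \ ∅) D) ∧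
      10 * D.card + s ≤ dartCount G X X + 2 * dartCount G X (closedStar G S v)) :
    HasSmallIsolating G S := by
  subst hX
  obtain ⟨D, hD, hc⟩ := h
  rw [Finset.sdiff_empty] at hD
  refine ⟨insert v D, hD.mono (undominated_insert_subset _ _ _), ?_⟩
  have h1 := Finset.card_insert_le v D
  -- The edges inside the closed star, with the slack `s`, pay the 10 for `v`; the cross edges,
  -- counted twice, have been spent on the components.
  have h2 := dartCount_split_self (G := G) (A := closedStar G S v) (S := S)
    (closedStar_subset hv)
  rw [dartCount_comm (closedStar G S v) (S \ _)] at h2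
  omega

section Bridgeless

variable {S : Finset V} (hB : Bridgeless G S)
  (ih : ∀ C ⊆ S, C ≠ S → InducesConnected G C → Classified G C) {v : V} (hv : v ∈ S)

include hB hv

theorem two_le_dartCount_component {C : Finset V}
    (hC : IsComponent G (S \ closedStar G S v) C) :
    2 ≤ dartCount G C (closedStar G S v) := by
  have hR := closedStar_subset (G := G) hv
  have hne : (closedStar G S v).Nonempty := ⟨v, mem_closedStar.mpr (Or.inl rfl)⟩
  rw [← hC.dartCount_compl hR]
  exact hB C (hC.1.trans Finset.sdiff_subset) hC.2.1.1 (hC.sdiff_nonempty hR hne)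

include ih

theorem exists_isolating_component {C : Finset V}
    (hC : IsComponent G (S \ closedStar G S v) C) (hT : ¬ G.IsNClique 3 C) :
    ∃ D, InducesForest G (undominated G (C \ ∅) D) ∧
      10 * D.card ≤ dartCount G C C + 2 := by
  rw [Finset.sdiff_empty]
  refine (ih C (hC.1.trans Finset.sdiff_subset) ?_ hC.2.1).exists_isolating hC.2.1 hT
  rintro rfl
  exact (Finset.mem_sdiff.mp (hC.1 hv)).2 (by simp [mem_closedStar])

theorem exists_isolating_component' {C : Finset V}
    (hC : IsComponent G (S \ closedStar G S v) C) :
    ∃ D, InducesForest G (undominated G (C \ ∅) D) ∧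
      10 * D.card ≤ dartCount G C C + 2 * dartCount G C (closedStar G S v) := by
  have h2 := two_le_dartCount_component hB hv hC
  by_cases hT : G.IsNClique 3 C
  · obtain ⟨D, h, hc⟩ := exists_isolating_isNClique_three hT
    exact ⟨D, by rwa [Finset.sdiff_empty], by omega⟩
  · obtain ⟨D, h, hc⟩ := exists_isolating_component hB ih hv hC hT
    exact ⟨D, h, by omega⟩

theorem hasSmallIsolating_of_ten_le
    (h : 10 ≤ dartCount G (closedStar G S v) (closedStar G S v)) : HasSmallIsolating G S :=
  hasSmallIsolating_of_closedStar hv rfl 0 h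
    (exists_isolating_of_components _ _ _ _ fun _ hC => exists_isolating_component' hB ih hv hC)

/-- With only 4 edges in the closed star, 2 is missing. A non-triangle component overspends by at
most 2 but receives at least 4, and a triangle with three outgoing edges receives 6 for its 4, so
either supplies the missing 2. -/
theorem hasSmallIsolating_of_eight_le
    (h : 8 ≤ dartCount G (closedStar G S v) (closedStar G S v)) {C : Finset V}
    (hC : IsComponent G (S \ closedStar G S v) C)
    (hC' : ¬ (G.IsNClique 3 C ∧ dartCount G C (closedStar G S v) = 2)) :
    HasSmallIsolating G S := by
  refine hasSmallIsolating_of_closedStar hv rfl 2 (by omega)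
    (exists_isolating_of_components_of_slack _ _ _ _ _ C hC ?_
      fun _ hC' => exists_isolating_component' hB ih hv (hC.of_sdiff hC'))
  have h2 := two_le_dartCount_component hB hv hC
  by_cases hT : G.IsNClique 3 C
  · obtain ⟨D, h, hc⟩ := exists_isolating_isNClique_three hT
    refine ⟨D, by rwa [Finset.sdiff_empty], ?_⟩
    have : dartCount G C (closedStar G S v) ≠ 2 := fun h => hC' ⟨hT, h⟩
    omega
  · obtain ⟨D, h, hc⟩ := exists_isolating_component hB ih hv hC hT
    exact ⟨D, h, by omega⟩

omit ih hB hv in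
theorem dartCount_four {x y z a : V} (hxy : G.Adj x y) (hxz : G.Adj x z) (hxa : G.Adj x a)
    (hyz : G.Adj y z) (hya : y ≠ a) (hza : z ≠ a) :
    dartCount G {x, y, z, a} {x, y, z, a} =
      8 + 2 * (if G.Adj y a then 1 else 0) + 2 * (if G.Adj z a then 1 else 0) := by
  rw [dartCount_insert_self (by simp [hxy.ne, hxz.ne, hxa.ne]),
    dartCount_insert_self (by simp [hyz.ne, hya]), dartCount_insert_self (by simp [hza]),
    dartCount_singleton_insert x (b := y) (by simp [hyz.ne, hya]),
    dartCount_singleton_insert x (b := z) (by simp [hza]),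
    dartCount_singleton_insert y (b := z) (by simp [hza])]
  simp only [dartCount_singleton, hxy, hxz, hxa, hyz, if_pos, SimpleGraph.irrefl, if_false]
  ring

/-- The triangle and the edge `va` already put 4 edges into the closed star. A fifth edge suffices,
and so does slack from one component, so failure forces this rigid structure. -/
theorem hasSmallIsolating_or_of_triangle {y z a : V} (hy : y ∈ S) (hz : z ∈ S) (ha : a ∈ S)
    (hvy : G.Adj v y) (hvz : G.Adj v z) (hva : G.Adj v a) (hyz : G.Adj y z) (hya : y ≠ a)
    (hza : z ≠ a) : HasSmallIsolating G S ∨ (closedStar G S v = {v, y, z, a} ∧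
      ¬ G.Adj y a ∧ ¬ G.Adj z a ∧ ∀ C, IsComponent G (S \ closedStar G S v) C →
        G.IsNClique 3 C ∧ dartCount G C (closedStar G S v) = 2) := by
  have hsub : ({v, y, z, a} : Finset V) ⊆ closedStar G S v := by
    intro w hw
    simp only [Finset.mem_insert, Finset.mem_singleton] at hw
    rw [mem_closedStar]
    rcases hw with rfl | rfl | rfl | rfl <;> tauto
  have hle := dartCount_mono (G := G) hsub hsub
  have h4 := dartCount_four hvy hvz hva hyz hya hza
  rw [h4] at hle
  by_cases e1 : G.Adj y a
  · exact Or.inl (hasSmallIsolating_of_ten_le hB ih hv (by simp [e1] at hle; omega))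
  by_cases e2 : G.Adj z a
  · exact Or.inl (hasSmallIsolating_of_ten_le hB ih hv (by simp [e2] at hle; omega))
  by_cases e3 : closedStar G S v = {v, y, z, a}
  · by_cases e4 : ∀ C, IsComponent G (S \ closedStar G S v) C →
        G.IsNClique 3 C ∧ dartCount G C (closedStar G S v) = 2
    · exact Or.inr ⟨e3, e1, e2, e4⟩
    · push Not at e4
      obtain ⟨C, hC, h⟩ := e4
      exact Or.inl (hasSmallIsolating_of_eight_le hB ih hv (by omega) hC (by tauto))
  · obtain ⟨w, hw, hw'⟩ := Finset.exists_of_ssubset (hsub.ssubset_of_ne (Ne.symm e3))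
    have hvw : G.Adj v w := by
      rcases mem_closedStar.mp hw with rfl | h
      · simp at hw'
      · exact h.2
    have h5 := dartCount_mono (G := G) (Finset.insert_subset hw hsub)
      (Finset.insert_subset hw hsub)
    rw [dartCount_insert_self hw', dartCount_singleton_insert _
      (by simp [hvy.ne, hvz.ne, hva.ne]), if_pos hvw.symm] at h5
    exact Or.inl (hasSmallIsolating_of_ten_le hB ih hv (by omega))

end Bridgeless

theorem exists_of_isNClique_three {T : Finset V} (hT : G.IsNClique 3 T) {p q : V} (hp : p ∈ T)
    (hq : q ∈ T) (hpq : p ≠ q) : ∃ r ∈ T, G.Adj p q ∧ G.Adj p r ∧ G.Adj q r := by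
  have h1 : ((T.erase p).erase q).card = 1 := by
    rw [Finset.card_erase_of_mem (by simp [hq, hpq.symm]), Finset.card_erase_of_mem hp, hT.card_eq]
  obtain ⟨r, hr⟩ := Finset.card_eq_one.mp h1
  have hr : r ∈ (T.erase p).erase q := by simp [hr]
  simp only [Finset.mem_erase] at hr
  exact ⟨r, hr.2.2, hT.isClique hp hq hpq, hT.isClique hp hr.2.2 (Ne.symm hr.2.1),
    hT.isClique hq hr.2.2 (Ne.symm hr.1)⟩

/-- The component `T` of `q` in `S - N[x]` is a triangle with exactly two edges to `N[x]`: one from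
`q` to `y` and one to `a`. Applying the rigid structure at a second vertex contradicts this. -/
theorem hasSmallIsolating_of_triangle_of_component {S : Finset V} (hB : Bridgeless G S)
    (ih : ∀ C ⊆ S, C ≠ S → InducesConnected G C → Classified G C) {x y z a q : V}
    {K : Finset V} (hx : x ∈ S) (hy : y ∈ S) (hz : z ∈ S)
    (hxy : G.Adj x y) (hxz : G.Adj x z) (hxa : G.Adj x a) (hyz : G.Adj y z) (hya : y ≠ a)
    (hstar : closedStar G S x = {x, y, z, a}) (hnya : ¬ G.Adj y a)
    (hcomp : ∀ C, IsComponent G (S \ closedStar G S x) C →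
        G.IsNClique 3 C ∧ dartCount G C (closedStar G S x) = 2)
    (hK : IsComponent G (S \ {x, y, z}) K) (haK : a ∈ K) (hqK : q ∈ K) (hqy : G.Adj q y)
    (hqa : q ≠ a) : HasSmallIsolating G S := by
  have haS := Finset.mem_sdiff.mp (hK.1 haK)
  have hqS := Finset.mem_sdiff.mp (hK.1 hqK)
  have hq : q ∈ S \ closedStar G S x := by
    rw [hstar]
    simp only [Finset.mem_sdiff, Finset.mem_insert, Finset.mem_singleton] at hqS ⊢
    tauto
  obtain ⟨T, hT, hqT⟩ := exists_isComponent_mem (G := G) hq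
  obtain ⟨cT, hT2⟩ := hcomp T hT
  have hTS : ∀ t ∈ T, t ∈ S ∧ t ≠ x ∧ t ≠ y ∧ t ≠ z ∧ t ≠ a := by
    intro t ht
    have := hT.1 ht
    rw [hstar] at this
    simpa using this
  -- Otherwise no edge leaves `T` in `S - {x, y, z}`, so `K ⊆ T`, although `a` lies in `K` and not
  -- in `T`.
  have hp : ∃ p ∈ T, G.Adj p a := by
    by_contra hno
    push Not at hno
    have h0 : dartCount G T ((S \ {x, y, z}) \ T) = 0 := by
      rw [dartCount_eq_zero_iff]
      intro t ht w hw htw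
      by_cases hwa : w = a
      · subst hwa; exact hno t ht htw
      · have : w ∈ S \ closedStar G S x := by
          rw [hstar]
          simp only [Finset.mem_sdiff, Finset.mem_insert, Finset.mem_singleton] at hw ⊢
          tauto
        exact (Finset.mem_sdiff.mp hw).2 (hT.mem_of_adj ht this htw)
    exact (hTS a (hK.subset_of_isClosed h0 ⟨q, by simp [hqK, hqT]⟩ haK)).2.2.2.2 rfl
  obtain ⟨p, hpT, hpa⟩ := hp
  have hyR : y ∈ closedStar G S x := by simp [hstar]
  have haR : a ∈ closedStar G S x := by simp [hstar]
  -- If `p = q`, the closed star of `p` would be `T` with `a`, yet it also contains `y`. If `p ≠ q`,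
  -- the structure at `y` puts `a`, `p` and the third vertex `r` of `T` in one triangle component,
  -- and `ra` is a third edge from `T` to `N[x]`.
  by_cases hpq : p = q
  · subst hpq
    obtain ⟨r, hr, hrp⟩ : ∃ r ∈ T, r ≠ p := Finset.exists_mem_ne (by rw [cT.card_eq]; norm_num) p
    obtain ⟨s, hs, h1, h2, h3⟩ := exists_of_isNClique_three cT hpT hr hrp.symm
    rcases hasSmallIsolating_or_of_triangle hB ih hqS.1 (hTS r hr).1 (hTS s hs).1 haS.1 h1 h2 hpa
      h3 (hTS r hr).2.2.2.2 (hTS s hs).2.2.2.2 with h | h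
    · exact h
    · have : y ∈ closedStar G S p := mem_closedStar.mpr (Or.inr ⟨hy, hqy⟩)
      rw [h.1] at this
      simp only [Finset.mem_insert, Finset.mem_singleton] at this
      rcases this with e | e | e | e
      · exact absurd e.symm (hTS p hpT).2.2.1
      · exact absurd e.symm (hTS r hr).2.2.1
      · exact absurd e.symm (hTS s hs).2.2.1
      · exact absurd e hya
  · obtain ⟨r, hr, h1, h2, h3⟩ := exists_of_isNClique_three cT hpT hqT hpq
    rcases hasSmallIsolating_or_of_triangle hB ih hy hx hz hqS.1 hxy.symm hyz hqy.symm hxz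
      (hTS q hqT).2.1.symm (hTS q hqT).2.2.2.1.symm with h | ⟨hs, -, -, hc⟩
    · exact h
    · have mem : ∀ w ∈ S, w ≠ x → w ≠ y → w ≠ z → w ≠ q → w ∈ S \ closedStar G S y := by
        intro w hw e1 e2 e3 e4
        rw [hs]
        simp [hw, e1, e2, e3, e4]
      have haz : a ≠ z := by rintro rfl; exact hnya hyz
      obtain ⟨C, hC, haC⟩ := exists_isComponent_mem (G := G)
        (mem a haS.1 hxa.ne' hya.symm haz hqa.symm)
      have hpC : p ∈ C := hC.mem_of_adj haC (mem p (hTS p hpT).1 (hTS p hpT).2.1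
        (hTS p hpT).2.2.1 (hTS p hpT).2.2.2.1 hpq) hpa.symm
      have hrC : r ∈ C := hC.mem_of_adj hpC (mem r (hTS r hr).1 (hTS r hr).2.1
        (hTS r hr).2.2.1 (hTS r hr).2.2.2.1 h3.ne') h2
      have hra : G.Adj r a := (hc C hC).1.isClique hrC haC (hTS r hr).2.2.2.2
      have := card_le_dartCount (G := G) (A := T) (B := closedStar G S x)
        {(p, a), (q, y), (r, a)} (by
          intro e he
          simp only [Finset.mem_insert, Finset.mem_singleton] at he
          rcases he with rfl | rfl | rfl
          · exact ⟨hpT, haR, hpa⟩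
          · exact ⟨hqT, hyR, hqy⟩
          · exact ⟨hr, haR, hra⟩)
      rw [Finset.card_insert_of_notMem (by simp [hpq, h2.ne]),
        Finset.card_pair (by simp [h3.ne]), hT2] at this
      omega

/-- In the rigid case, bridgelessness gives the component of `a` in `S - {x, y, z}` a second edge
`qw` to the triangle. As `N[x] = {x, y, z, a}` and `a` is adjacent to neither `y` nor `z`, `q ≠ a`
and `w` is `y` or `z`. -/
theorem hasSmallIsolating_of_triangle {S : Finset V} (hB : Bridgeless G S)
    (ih : ∀ C ⊆ S, C ≠ S → InducesConnected G C → Classified G C) {x y z a : V}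
    (hx : x ∈ S) (hy : y ∈ S) (hz : z ∈ S) (ha : a ∈ S)
    (hxy : G.Adj x y) (hxz : G.Adj x z) (hxa : G.Adj x a) (hyz : G.Adj y z) (hya : y ≠ a)
    (hza : z ≠ a) : HasSmallIsolating G S := by
  rcases hasSmallIsolating_or_of_triangle hB ih hx hy hz ha hxy hxz hxa hyz hya hza with
    h | ⟨hs, h1, h2, hc⟩
  · exact h
  have haX : a ∈ S \ {x, y, z} := by simp [ha, hxa.ne', hya.symm, hza.symm]
  obtain ⟨K, hK, haK⟩ := exists_isComponent_mem (G := G) haX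
  have hTS : ({x, y, z} : Finset V) ⊆ S := by simp [Finset.insert_subset_iff, hx, hy, hz]
  have h3 := hB K (hK.1.trans Finset.sdiff_subset) hK.2.1.1
    (hK.sdiff_nonempty hTS ⟨x, by simp⟩)
  rw [hK.dartCount_compl hTS, dartCount_eq_card] at h3
  obtain ⟨⟨q, w⟩, hqw, hne⟩ := Finset.exists_mem_ne h3 (a, x)
  simp only [Finset.mem_filter, Finset.mem_product, Finset.mem_insert,
    Finset.mem_singleton] at hqw
  obtain ⟨⟨hqK, hw⟩, hadj⟩ := hqw
  have hqS := Finset.mem_sdiff.mp (hK.1 hqK)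
  have hqT : q ≠ x ∧ q ≠ y ∧ q ≠ z := by simpa using hqS.2
  have hqa : q ≠ a := by
    rintro rfl
    rcases hw with rfl | rfl | rfl
    · exact hne rfl
    · exact h1 hadj.symm
    · exact h2 hadj.symm
  rcases hw with rfl | rfl | rfl
  · have : q ∈ closedStar G S w := mem_closedStar.mpr (Or.inr ⟨hqS.1, hadj.symm⟩)
    rw [hs] at this
    simp at this
    tauto
  · exact hasSmallIsolating_of_triangle_of_component hB ih hx hy hz hxy hxz hxa hyz hya hs h1 hc
      hK haK hqK hadj hqa
  · refine hasSmallIsolating_of_triangle_of_component hB ih hx hz hy hxz hxy hxa hyz.symm hza ?_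
      h2 hc (K := K) ?_ haK hqK hadj hqa
    · rw [hs, Finset.insert_comm y w]
    · rwa [Finset.pair_comm w y]

/-- Bridgeless and triangle-free, with a vertex of degree at least three. -/
theorem hasSmallIsolating_of_triangleFree {S : Finset V} (hB : Bridgeless G S)
    (ih : ∀ C ⊆ S, C ≠ S → InducesConnected G C → Classified G C)
    (hT : ∀ T ⊆ S, ¬ G.IsNClique 3 T) {v : V} (hv : v ∈ S) (hd : 3 ≤ dartCount G {v} S) :
    HasSmallIsolating G S := by
  set R := closedStar G S v with hR
  set N : Finset V := {w ∈ S | G.Adj v w} with hN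
  have hRN : R = insert v N := rfl
  have hvN : v ∉ N := by simp [hN]
  have hRS : R ⊆ S := closedStar_subset hv
  have hNc : 3 ≤ N.card := by rwa [dartCount_singleton_left] at hd
  have hRR : 6 ≤ dartCount G R R := by
    rw [hRN, dartCount_insert_self hvN, dartCount_singleton_left, Finset.filter_true_of_mem]
    · omega
    · intro w hw; exact (Finset.mem_filter.mp hw).2
  -- Each neighbour of `v` has a second neighbour, which lies outside `N[v]` because there are no
  -- triangles.
  have hX : 3 ≤ dartCount G (S \ R) R := by
    rw [dartCount_comm]
    refine hNc.trans ?_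
    refine le_trans ?_ (dartCount_mono (G := G) (A := N)
      (by rw [hRN]; exact Finset.subset_insert _ _) le_rfl)
    rw [dartCount_eq_sum, Finset.card_eq_sum_ones]
    refine Finset.sum_le_sum fun a ha => ?_
    obtain ⟨haS, hva⟩ := Finset.mem_filter.mp ha
    have h2 := hB {a} (by simpa using haS) (by simp) ⟨v, by simp [hv, hva.ne]⟩
    rw [dartCount_eq_card] at h2
    obtain ⟨⟨a', w⟩, hw, hne⟩ := Finset.exists_mem_ne h2 (a, v)
    simp only [Finset.mem_filter, Finset.mem_product, Finset.mem_singleton,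
      Finset.mem_sdiff] at hw
    obtain ⟨⟨rfl, hwS, -⟩, haw⟩ := hw
    refine dartCount_pos_iff.mpr ⟨a', by simp, w, ?_, haw⟩
    rw [Finset.mem_sdiff, hR, mem_closedStar]
    refine ⟨hwS, ?_⟩
    rintro (rfl | ⟨-, hvw⟩)
    · exact hne rfl
    · refine hT {v, a', w} ?_ (SimpleGraph.is3Clique_triple_iff.mpr ⟨hva, hvw, haw⟩)
      simp [Finset.insert_subset_iff, hv, haS, hwS]
  -- No component is a triangle, so counting each cross edge once is enough. The second count of at
  -- least 3, with the 6 inside `N[v]`, gives 9 of the 10 needed for `v`; parity gives the last.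
  obtain ⟨D, hD, hc⟩ := exists_isolating_of_components (G := G) ∅ R 1 (S \ R) fun C hC => by
    have h2 : 2 ≤ dartCount G C R := two_le_dartCount_component hB hv hC
    obtain ⟨D, h, hc⟩ := exists_isolating_component hB ih hv hC
      (hT C (hC.1.trans Finset.sdiff_subset))
    exact ⟨D, h, by omega⟩
  rw [Finset.sdiff_empty] at hD
  refine ⟨insert v D, hD.mono (undominated_insert_subset _ _ _), ?_⟩
  have h1 := Finset.card_insert_le v D
  have h2 := dartCount_split_self (G := G) hRS
  rw [dartCount_comm R (S \ _)] at h2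
  obtain ⟨k, hk⟩ := even_dartCount_self (G := G) S
  omega

/-- Deleting a vertex of a cycle leaves a forest. -/
theorem inducesForest_erase_of_degree_two {S : Finset V} (hB : Bridgeless G S)
    (hd : ∀ v ∈ S, dartCount G {v} S ≤ 2) {v : V} (hv : v ∈ S) : InducesForest G (S.erase v) := by
  intro Y hY hne
  have hYS : Y ⊆ S := hY.trans (Finset.erase_subset _ _)
  have h1 := hB Y hYS hne
    ⟨v, Finset.mem_sdiff.mpr ⟨hv, fun h => Finset.ne_of_mem_erase (hY h) rfl⟩⟩
  have h2 := dartCount_split_right (G := G) hYS Y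
  have h3 : dartCount G Y S ≤ Y.card * 2 := by
    rw [dartCount_eq_sum]
    exact Finset.sum_le_card_nsmul _ _ _ fun y hy => hd y (hYS hy)
  omega

theorem classified_of_bridgeless {S : Finset V} (hS : InducesConnected G S)
    (hB : Bridgeless G S) (ih : ∀ C ⊆ S, C ≠ S → InducesConnected G C → Classified G C) :
    Classified G S := by
  obtain ⟨v, hv⟩ := hS.1
  by_cases h1 : S = {v}
  · subst h1
    exact Or.inr (Or.inl ⟨∅, inducesForest_of_card_le_two
      ((Finset.card_le_card (undominated_subset _ _)).trans (by simp)), by simp⟩)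
  have hdeg : ∀ a ∈ S, 2 ≤ dartCount G {a} S := by
    intro a ha
    refine (hB {a} (by simpa using ha) (by simp) ?_).trans
      (dartCount_mono le_rfl Finset.sdiff_subset)
    rw [Finset.sdiff_nonempty]
    intro h
    have h2 := Finset.eq_of_subset_of_card_le h (by
      rw [Finset.card_singleton]; exact Finset.card_pos.mpr ⟨v, hv⟩)
    rw [h2] at hv h1
    exact h1 (by rw [Finset.mem_singleton.mp hv])
  by_cases hT : ∃ T ⊆ S, G.IsNClique 3 T
  · obtain ⟨T, hTS, hT⟩ := hT
    by_cases hTe : T = S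
    · exact Or.inl (hTe ▸ hT)
    have hne : (S \ T).Nonempty := by
      rw [Finset.sdiff_nonempty]
      exact fun h => hTe (hTS.antisymm h)
    have hTne : T.Nonempty := by rw [← Finset.card_pos, hT.card_eq]; norm_num
    obtain ⟨x, hx, a, ha, hxa⟩ := dartCount_pos_iff.mp (hS.2 T hTS hTne hne)
    obtain ⟨y, hy, hyx⟩ := Finset.exists_mem_ne (by rw [hT.card_eq]; norm_num) x
    obtain ⟨z, hz, h1, h2, h3⟩ := exists_of_isNClique_three hT hx hy hyx.symm
    rw [Finset.mem_sdiff] at ha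
    refine Or.inr (Or.inl (hasSmallIsolating_of_triangle hB ih (hTS hx) (hTS hy) (hTS hz) ha.1
      h1 h2 hxa h3 ?_ ?_))
    · rintro rfl; exact ha.2 hy
    · rintro rfl; exact ha.2 hz
  push Not at hT
  by_cases h3 : ∃ a ∈ S, 3 ≤ dartCount G {a} S
  · obtain ⟨a, ha, h⟩ := h3
    exact Or.inr (Or.inl (hasSmallIsolating_of_triangleFree hB ih hT ha h))
  push Not at h3
  have hd2 : ∀ a ∈ S, dartCount G {a} S = 2 := fun a ha => by
    have := hdeg a ha; have := h3 a ha; omega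
  have hfor : ∀ a ∈ S, InducesForest G (S.erase a) := fun a ha =>
    inducesForest_erase_of_degree_two hB (fun b hb => (hd2 b hb).le) ha
  have hcard : dartCount G S S = S.card * 2 := by
    rw [dartCount_eq_sum, Finset.sum_congr rfl hd2, Finset.sum_const, smul_eq_mul]
  by_cases h5 : 5 ≤ S.card
  -- All degrees are 2, so there are as many edges as vertices, and at least five of them pay for a
  -- single vertex.
  · refine Or.inr (Or.inl ⟨{v}, (hfor v hv).mono ?_, by rw [hcard, Finset.card_singleton]; omega⟩)
    intro w
    simp only [mem_undominated, Finset.mem_singleton, forall_eq, Finset.mem_erase]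
    tauto
  by_cases h4 : S.card = 4
  · exact Or.inr (Or.inr (Or.inr ⟨h4, hd2, hfor⟩))
  exfalso
  have h2 := hd2 v hv
  rw [dartCount_singleton_left] at h2
  obtain ⟨a, b, hab, he⟩ := Finset.card_eq_two.mp h2
  have ha : a ∈ ({w ∈ S | G.Adj v w} : Finset V) := by simp [he]
  have hb : b ∈ ({w ∈ S | G.Adj v w} : Finset V) := by simp [he]
  rw [Finset.mem_filter] at ha hb
  have hsub : ({v, a, b} : Finset V) ⊆ S := by
    simp [Finset.insert_subset_iff, hv, ha.1, hb.1]
  have hc3 : ({v, a, b} : Finset V).card = 3 :=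
    Finset.card_eq_three.mpr ⟨v, a, b, ha.2.ne, hb.2.ne, hab, rfl⟩
  have hSe := Finset.eq_of_subset_of_card_le hsub (by omega)
  have h2 := hd2 a ha.1
  rw [← hSe, dartCount_singleton_insert _ (by simp [ha.2.ne, hb.2.ne]),
    dartCount_singleton_insert _ (by simpa using hab), dartCount_singleton] at h2
  by_cases hadj : G.Adj a b
  · exact hT _ hsub (SimpleGraph.is3Clique_triple_iff.mpr ⟨ha.2, hb.2, hadj⟩)
  · simp only [SimpleGraph.irrefl, if_false, hadj] at h2
    split_ifs at h2 <;> omega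

/-- A pendant triangle, when no other edge is a bridge between two non-triangles. -/
theorem classified_of_pendant_triangle {S T : Finset V} (hS : InducesConnected G S)
    (hTS : T ⊆ S) (hT : G.IsNClique 3 T) (h1 : dartCount G T (S \ T) = 1)
    (hbr : ∀ A ⊆ S, dartCount G A (S \ A) = 1 → G.IsNClique 3 A ∨ G.IsNClique 3 (S \ A))
    (ih : ∀ C ⊆ S, C ≠ S → InducesConnected G C → Classified G C) : Classified G S := by
  have hTne : T.Nonempty := by rw [← Finset.card_pos, hT.card_eq]; norm_num
  obtain ⟨t, ht, b, hb, htb⟩ := dartCount_pos_iff.mp (h1 ▸ Nat.one_pos)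
  obtain ⟨hbS, hbT⟩ := Finset.mem_sdiff.mp hb
  have hbsub : ({b} : Finset V) ⊆ S := by simpa using hbS
  have hTX : T ⊆ S \ {b} := fun w hw => by
    simp only [Finset.mem_sdiff, Finset.mem_singleton]
    exact ⟨hTS hw, by rintro rfl; exact hbT hw⟩
  have hsp := dartCount_split_right (G := G) (show {b} ⊆ S \ T by simpa using hb) T
  have htb1 : 1 ≤ dartCount G T {b} := dartCount_pos_iff.mpr ⟨t, ht, b, by simp, htb⟩
  have hTb : dartCount G T {b} = 1 := by omega
  have hTc : dartCount G T ((S \ {b}) \ T) = 0 := by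
    rw [sdiff_right_comm]; omega
  by_cases hSe : (S \ {b}) \ T = ∅
  · refine Or.inr (Or.inr (Or.inl ⟨{b}, ?_⟩))
    have : S = insert b T := by
      rw [Finset.sdiff_eq_empty_iff_subset] at hSe
      rw [← Finset.Subset.antisymm hSe hTX, Finset.sdiff_singleton_eq_erase,
        Finset.insert_erase hbS]
    rw [this]
    exact .single hT hbT hTb
  have hYne : ((S \ {b}) \ T).Nonempty := Finset.nonempty_iff_ne_empty.mpr hSe
  have hT' : IsComponent G (S \ {b}) T :=
    ⟨hTX, inducesConnected_of_dartCount_eq_one hS hTS hTne h1, hTc⟩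
  have hstar : ∀ C, G.IsNClique 3 C → C ⊆ S → 1 ≤ dartCount G C {b} →
      InducesForest G (undominated G (C \ closedStar G S b) ∅) := by
    intro C hC hCS h
    obtain ⟨c, hc, b', hb', hcb⟩ := dartCount_pos_iff.mp h
    rw [Finset.mem_singleton] at hb'
    subst hb'
    refine inducesForest_of_card_le_two ?_
    refine (Finset.card_le_card (t := C.erase c) ?_).trans ?_
    · refine (undominated_subset _ _).trans fun w hw => ?_
      rw [Finset.mem_sdiff, mem_closedStar] at hw
      rw [Finset.mem_erase]
      refine ⟨?_, hw.1⟩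
      rintro rfl
      exact hw.2 (Or.inr ⟨hCS hw.1, hcb.symm⟩)
    · rw [Finset.card_erase_of_mem hc, hC.card_eq]
  have hcomp : ∀ C, IsComponent G (S \ {b}) C → 1 ≤ dartCount G C {b} := by
    intro C hC
    rw [← hC.dartCount_compl hbsub]
    exact hS.2 C (hC.1.trans Finset.sdiff_subset) hC.2.1.1 (hC.sdiff_nonempty hbsub (by simp))
  -- The slack 7 comes from `T`: its 6 darts and its edge to `b`, with nothing spent because `b`
  -- dominates a vertex of `T`.
  obtain ⟨D, hD, hc⟩ := exists_isolating_of_components_of_slack (closedStar G S b) {b} 1 7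
    (S \ {b}) T hT'
    ⟨∅, hstar T hT hTS hTb.ge, by rw [dartCount_of_isNClique_three hT, hTb]; simp⟩ (by
      intro C hCT
      have hC := hT'.of_sdiff hCT
      have hCS := hC.1.trans Finset.sdiff_subset
      by_cases hCc : G.IsNClique 3 C
      · exact ⟨∅, hstar C hCc hCS (hcomp C hC), by simp⟩
      have hbC : b ∉ C := fun h => (Finset.mem_sdiff.mp (hC.1 h)).2 (by simp)
      obtain ⟨D, hD, hc⟩ := (ih C hCS (fun h => hbC (h ▸ hbS)) hC.2.1).exists_isolating
        hC.2.1 hCc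
      refine ⟨D, hD.mono (undominated_mono Finset.sdiff_subset le_rfl), ?_⟩
      -- A single edge to `b` would be a bridge, but `C` is not a triangle and the other side
      -- contains the four vertices of `insert b T`.
      have h2 : dartCount G C {b} ≠ 1 := by
        intro h
        rw [← hC.dartCount_compl hbsub] at h
        rcases hbr C hCS h with h | h
        · exact hCc h
        · have hsub : insert b T ⊆ S \ C := by
            intro w hw
            rw [Finset.mem_insert] at hw
            rw [Finset.mem_sdiff]
            rcases hw with rfl | hw
            · exact ⟨hbS, hbC⟩
            · exact ⟨hTS hw, fun hwC => (Finset.mem_sdiff.mp (hCT.1 hwC)).2 hw⟩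
          have := Finset.card_le_card hsub
          rw [Finset.card_insert_of_notMem hbT, hT.card_eq, h.card_eq] at this
          omega
      have := hcomp C hC
      omega)
  have hYb : 1 ≤ dartCount G ((S \ {b}) \ T) {b} := by
    obtain ⟨y, hy⟩ := hYne
    obtain ⟨C, hC, -⟩ := exists_isComponent_mem (G := G) hy
    exact (hcomp C (hT'.of_sdiff hC)).trans (dartCount_mono hC.1 le_rfl)
  have hXb := dartCount_split_left (G := G) hTX {b}
  refine Or.inr (Or.inl ⟨insert b D, hD.mono ?_, ?_⟩)
  · refine (undominated_insert_subset _ _ _).trans (undominated_mono ?_ le_rfl)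
    intro w hw
    rw [Finset.mem_sdiff] at hw ⊢
    refine ⟨Finset.mem_sdiff.mpr ⟨hw.1, ?_⟩, hw.2⟩
    rw [Finset.mem_singleton]
    rintro rfl
    exact hw.2 (mem_closedStar.mpr (Or.inl rfl))
  · have h1 := Finset.card_insert_le b D
    have h2 := dartCount_split_self (G := G) hbsub
    rw [dartCount_comm {b} (S \ _), dartCount_singleton_self] at h2
    -- The slack 7 and the second count of at least two edges at `b` give 9; parity supplies the
    -- tenth unit.
    obtain ⟨k, hk⟩ := even_dartCount_self (G := G) S
    omega

theorem InducesConnected.classified (S : Finset V) (hS : InducesConnected G S) :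
    Classified G S := by
  induction hn : S.card using Nat.strong_induction_on generalizing S with
  | _ n ih =>
    have ih' : ∀ C ⊆ S, C ≠ S → InducesConnected G C → Classified G C := fun C hC hne hCc =>
      ih C.card (hn ▸ Finset.card_lt_card (hC.ssubset_of_ne hne)) C hCc rfl
    have hne : ∀ A ⊆ S, dartCount G A (S \ A) = 1 → A.Nonempty ∧ (S \ A).Nonempty := by
      intro A hA h
      constructor <;> rw [Finset.nonempty_iff_ne_empty] <;> intro h0 <;> rw [h0] at h <;> simp at h
    by_cases hI : ∀ A ⊆ S, dartCount G A (S \ A) = 1 → G.IsNClique 3 A ∨ G.IsNClique 3 (S \ A)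
    · by_cases hII : ∃ A ⊆ S, dartCount G A (S \ A) = 1
      · obtain ⟨A, hA, h⟩ := hII
        rcases hI A hA h with hT | hT
        · exact classified_of_pendant_triangle hS hA hT h hI ih'
        · refine classified_of_pendant_triangle hS Finset.sdiff_subset hT ?_ hI ih'
          rwa [Finset.sdiff_sdiff_eq_self hA, dartCount_comm]
      · push Not at hII
        refine classified_of_bridgeless hS (fun A hA h1 h2 => ?_) ih'
        have := hS.2 A hA h1 h2
        have := hII A hA
        omega
    · push Not at hI
      obtain ⟨A, hA, h1, hTA, hTB⟩ := hI
      obtain ⟨n1, n2⟩ := hne A hA h1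
      have h1' : dartCount G (S \ A) (S \ (S \ A)) = 1 := by
        rwa [Finset.sdiff_sdiff_eq_self hA, dartCount_comm]
      have cA := inducesConnected_of_dartCount_eq_one hS hA n1 h1
      have cB := inducesConnected_of_dartCount_eq_one hS Finset.sdiff_subset n2 h1'
      have eA : A ≠ S := by rintro rfl; simp at n2
      have eB : S \ A ≠ S := by
        intro h
        rw [Finset.sdiff_eq_self_iff_disjoint] at h
        obtain ⟨x, hx⟩ := n1
        exact Finset.disjoint_left.mp h (hA hx) hx
      have := classified_union Finset.disjoint_sdiff h1 cA cB hTA hTB (ih' A hA eA cA)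
        (ih' (S \ A) Finset.sdiff_subset eB cB)
      rwa [Finset.union_sdiff_of_subset hA] at this

end Hub

/-! ### From the inductive description of pure graphs to `SpecialData` -/

section Pure

variable {V : Type u} [DecidableEq V] {G : SimpleGraph V} [DecidableRel G.Adj]

/-- A subset with no edges to its complement contains each of `A` and `B` or misses it, and the
cross edge rules out a mixed outcome. -/
theorem InducesConnected.union {A B : Finset V} (hA : InducesConnected G A)
    (hB : InducesConnected G B) (h : 0 < dartCount G A B) : InducesConnected G (A ∪ B) := by
  refine ⟨hA.1.mono Finset.subset_union_left, fun C hC hne hne' => ?_⟩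
  by_contra h0
  have h0 : dartCount G C ((A ∪ B) \ C) = 0 := by omega
  have split : ∀ X, InducesConnected G X → X ⊆ A ∪ B → X ⊆ C ∨ Disjoint X C := by
    intro X hX hXs
    by_contra hno
    rw [not_or, Finset.not_disjoint_iff_nonempty_inter, ← Finset.sdiff_nonempty] at hno
    have h1 := hX.2 (X ∩ C) Finset.inter_subset_left hno.2
      (by rw [Finset.sdiff_inter_self_left]; exact hno.1)
    have h2 := dartCount_mono (G := G) (A := X ∩ C) (B := X \ (X ∩ C)) Finset.inter_subset_right
      (show X \ (X ∩ C) ⊆ (A ∪ B) \ C by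
        rw [Finset.sdiff_inter_self_left]; exact Finset.sdiff_subset_sdiff hXs le_rfl)
    omega
  have out : ∀ X ⊆ A ∪ B, Disjoint X C → X ⊆ (A ∪ B) \ C := fun X hX hXC x hx =>
    Finset.mem_sdiff.mpr ⟨hX hx, Finset.disjoint_left.mp hXC hx⟩
  rcases split A hA Finset.subset_union_left with h1 | h1 <;>
    rcases split B hB Finset.subset_union_right with h2 | h2
  · rw [Finset.sdiff_nonempty] at hne'
    exact hne' (Finset.union_subset h1 h2)
  · have := dartCount_mono (G := G) h1 (out B Finset.subset_union_right h2)
    omega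
  · have := dartCount_mono (G := G) h2 (out A Finset.subset_union_left h1)
    rw [dartCount_comm B A] at this
    omega
  · obtain ⟨c, hc⟩ := hne
    rcases Finset.mem_union.mp (hC hc) with h3 | h3
    · exact Finset.disjoint_left.mp h1 h3 hc
    · exact Finset.disjoint_left.mp h2 h3 hc

theorem inducesConnected_singleton (a : V) : InducesConnected G {a} := by
  refine ⟨by simp, fun A hA hne hne' => ?_⟩
  rcases Finset.subset_singleton_iff.mp hA with rfl | rfl
  · simp at hne
  · simp at hne'

theorem InducesPure.dartCount_self {S W : Finset V} (h : InducesPure G S W) :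
    dartCount G S S + 2 = 10 * W.card := by
  induction h with
  | single hT hb h1 =>
    rw [dartCount_insert_self hb, dartCount_of_isNClique_three hT, dartCount_comm, h1]
    simp
  | join p₁ p₂ hd h1 ha hb hab ih₁ ih₂ =>
    rw [dartCount_union_self hd, h1,
      Finset.card_union_of_disjoint (hd.mono p₁.subset p₂.subset)]
    omega

/-- Connected with one edge fewer than vertices: `W` spans the quotient tree. -/
theorem InducesPure.connections {S W : Finset V} (h : InducesPure G S W) :
    InducesConnected G W ∧ dartCount G W W + 2 = 2 * W.card := by
  induction h with
  | @single _ b => exact ⟨inducesConnected_singleton b, by simp⟩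
  | @join S₁ W₁ S₂ W₂ a b p₁ p₂ hd h1 ha hb hab ih₁ ih₂ =>
    have hdW := hd.mono p₁.subset p₂.subset
    have h2 : 0 < dartCount G W₁ W₂ := dartCount_pos_iff.mpr ⟨_, ha, _, hb, hab⟩
    have h3 := dartCount_mono (G := G) p₁.subset p₂.subset
    refine ⟨ih₁.1.union ih₂.1 h2, ?_⟩
    rw [dartCount_union_self hdW, Finset.card_union_of_disjoint hdW]
    omega

/-- `u` lists the triangles attached to the connections `W` of a pure special graph on `S`. -/
structure IsTriangleListing (G : SimpleGraph V) (S W : Finset V) (u : V → Fin 3 → V) : Prop where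
  mem : ∀ w ∈ W, ∀ i, u w i ∈ S
  notMem : ∀ w ∈ W, ∀ i, u w i ∉ W
  eq : ∀ w ∈ W, ∀ w' ∈ W, ∀ i j, u w i = u w' j → w = w' ∧ i = j
  exists_eq : ∀ x ∈ S, x ∉ W → ∃ w ∈ W, ∃ i, x = u w i
  adj : ∀ w ∈ W, ∀ i j, i ≠ j → G.Adj (u w i) (u w j)
  adj_zero : ∀ w ∈ W, G.Adj w (u w 0)
  of_adj : ∀ w ∈ W, ∀ i, ∀ y ∈ S, G.Adj (u w i) y → (∃ j, y = u w j) ∨ (i = 0 ∧ y = w)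

theorem InducesPure.exists_listing {S W : Finset V} (h : InducesPure G S W) :
    ∃ u, IsTriangleListing G S W u := by
  induction h with
  | @single T b hT hb h1 =>
    obtain ⟨x, hx, c, hc, hxb⟩ := dartCount_pos_iff.mp (h1 ▸ Nat.one_pos)
    rw [Finset.mem_singleton] at hc
    subst hc
    obtain ⟨y, hy, hyx⟩ := Finset.exists_mem_ne (by rw [hT.card_eq]; norm_num) x
    obtain ⟨z, hz, hxy, hxz, hyz⟩ := exists_of_isNClique_three hT hx hy hyx.symm
    have hTe : T = {x, y, z} := by
      refine (Finset.eq_of_subset_of_card_le ?_ ?_).symm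
      · simp [Finset.insert_subset_iff, hx, hy, hz]
      · rw [hT.card_eq, Finset.card_eq_three.mpr ⟨x, y, z, hxy.ne, hxz.ne, hyz.ne, rfl⟩]
    have hu : ∀ i, (![x, y, z] : Fin 3 → V) i ∈ T := by
      intro i; fin_cases i <;> simp [hx, hy, hz]
    have hadj : ∀ i j, i ≠ j → G.Adj ((![x, y, z] : Fin 3 → V) i) ((![x, y, z] : Fin 3 → V) j) := by
      intro i j hij
      fin_cases i <;> fin_cases j <;>
        first
        | exact absurd rfl hij
        | simp [hxy, hxz, hyz, hxy.symm, hxz.symm, hyz.symm]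
    refine ⟨fun _ => ![x, y, z], fun _ _ i => by simp [hu i], ?_, ?_, ?_,
      fun _ _ => hadj, ?_, ?_⟩
    · intro _ _ i h
      rw [Finset.mem_singleton] at h
      exact hb (h ▸ hu i)
    · intro w hw w' hw' i j h
      rw [Finset.mem_singleton] at hw hw'
      refine ⟨hw.trans hw'.symm, ?_⟩
      by_contra hij
      exact (hadj i j hij).ne h
    · intro t ht htc
      have : t ∈ T := by simpa [show t ≠ c by simpa using htc] using ht
      rw [hTe] at this
      simp only [Finset.mem_insert, Finset.mem_singleton] at this
      refine ⟨c, by simp, ?_⟩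
      rcases this with rfl | rfl | rfl
      · exact ⟨0, rfl⟩
      · exact ⟨1, rfl⟩
      · exact ⟨2, rfl⟩
    · intro w hw
      rw [Finset.mem_singleton] at hw
      subst hw
      exact hxb.symm
    · intro w hw i t ht hit
      rw [Finset.mem_singleton] at hw
      subst hw
      rcases Finset.mem_insert.mp ht with rfl | htT
      · right
        have := (eq_of_dartCount_eq_one h1 hx (Finset.mem_singleton_self _) hxb (hu i)
          (Finset.mem_singleton_self _) hit).1
        refine ⟨?_, rfl⟩
        by_contra h0
        exact (hadj i 0 h0).ne this
      · left
        rw [hTe] at htT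
        simp only [Finset.mem_insert, Finset.mem_singleton] at htT
        rcases htT with rfl | rfl | rfl
        · exact ⟨0, rfl⟩
        · exact ⟨1, rfl⟩
        · exact ⟨2, rfl⟩
  | @join S₁ W₁ S₂ W₂ a b p₁ p₂ hd h1 ha hb hab ih₁ ih₂ =>
    obtain ⟨u₁, l₁⟩ := ih₁
    obtain ⟨u₂, l₂⟩ := ih₂
    have e₁ : ∀ w ∈ W₁, (fun w => if w ∈ W₁ then u₁ w else u₂ w) w = u₁ w := fun w hw => if_pos hw
    have e₂ : ∀ w ∈ W₂, (fun w => if w ∈ W₁ then u₁ w else u₂ w) w = u₂ w := fun w hw =>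
      if_neg fun h => Finset.disjoint_left.mp hd (p₁.subset h) (p₂.subset hw)
    generalize (fun w => if w ∈ W₁ then u₁ w else u₂ w) = u at e₁ e₂
    have hdis : ∀ s ∈ S₁, ∀ t ∈ S₂, s ≠ t := fun s hs t ht h =>
      Finset.disjoint_left.mp hd hs (h ▸ ht)
    refine ⟨u, ?_, ?_, ?_, ?_, ?_, ?_, ?_⟩
    · intro w hw i
      rcases Finset.mem_union.mp hw with hw | hw
      · rw [e₁ w hw]; exact Finset.mem_union_left _ (l₁.mem w hw i)
      · rw [e₂ w hw]; exact Finset.mem_union_right _ (l₂.mem w hw i)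
    · intro w hw i
      rw [Finset.mem_union, not_or]
      rcases Finset.mem_union.mp hw with hw | hw
      · rw [e₁ w hw]
        exact ⟨l₁.notMem w hw i, fun h => hdis _ (l₁.mem w hw i) _ (p₂.subset h) rfl⟩
      · rw [e₂ w hw]
        exact ⟨fun h => hdis _ (p₁.subset h) _ (l₂.mem w hw i) rfl, l₂.notMem w hw i⟩
    · intro w hw w' hw' i j h
      rcases Finset.mem_union.mp hw with hw | hw <;> rcases Finset.mem_union.mp hw' with hw' | hw'
      · rw [e₁ w hw, e₁ w' hw'] at h; exact l₁.eq w hw w' hw' i j h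
      · rw [e₁ w hw, e₂ w' hw'] at h
        exact absurd h (hdis _ (l₁.mem w hw i) _ (l₂.mem w' hw' j))
      · rw [e₂ w hw, e₁ w' hw'] at h
        exact absurd h.symm (hdis _ (l₁.mem w' hw' j) _ (l₂.mem w hw i))
      · rw [e₂ w hw, e₂ w' hw'] at h; exact l₂.eq w hw w' hw' i j h
    · intro x hx hxW
      rw [Finset.mem_union, not_or] at hxW
      rcases Finset.mem_union.mp hx with hx | hx
      · obtain ⟨w, hw, i, h⟩ := l₁.exists_eq x hx hxW.1
        exact ⟨w, Finset.mem_union_left _ hw, i, by rw [e₁ w hw, h]⟩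
      · obtain ⟨w, hw, i, h⟩ := l₂.exists_eq x hx hxW.2
        exact ⟨w, Finset.mem_union_right _ hw, i, by rw [e₂ w hw, h]⟩
    · intro w hw
      rcases Finset.mem_union.mp hw with hw | hw
      · rw [e₁ w hw]; exact l₁.adj w hw
      · rw [e₂ w hw]; exact l₂.adj w hw
    · intro w hw
      rcases Finset.mem_union.mp hw with hw | hw
      · rw [e₁ w hw]; exact l₁.adj_zero w hw
      · rw [e₂ w hw]; exact l₂.adj_zero w hw
    · intro w hw i y hy h
      rcases Finset.mem_union.mp hw with hw | hw <;> rcases Finset.mem_union.mp hy with hy | hy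
      · rw [e₁ w hw] at h ⊢; exact l₁.of_adj w hw i y hy h
      · rw [e₁ w hw] at h
        have := (eq_of_dartCount_eq_one h1 (p₁.subset ha) (p₂.subset hb) hab
          (l₁.mem w hw i) hy h).1
        exact absurd (this ▸ ha) (l₁.notMem w hw i)
      · rw [e₂ w hw] at h
        have := (eq_of_dartCount_eq_one h1 (p₁.subset ha) (p₂.subset hb) hab
          hy (l₂.mem w hw i) h.symm).2
        exact absurd (this ▸ hb) (l₂.notMem w hw i)
      · rw [e₂ w hw] at h ⊢; exact l₂.of_adj w hw i y hy h

theorem dartCount_univ [Fintype V] :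
    dartCount G Finset.univ Finset.univ = 2 * G.edgeSet.ncard := by
  rw [dartCount_eq_sum, ← SimpleGraph.coe_edgeFinset, Set.ncard_coe_finset,
    ← G.sum_degrees_eq_twice_card_edges]
  refine Finset.sum_congr rfl fun v _ => ?_
  rw [dartCount_singleton_left, ← G.card_neighborFinset_eq_degree, G.neighborFinset_eq_filter]

theorem inducesConnected_univ [Fintype V] (h : G.Connected) :
    InducesConnected G Finset.univ := by
  refine ⟨have := h.nonempty; Finset.univ_nonempty, fun A _ ⟨a, ha⟩ ⟨b, hb⟩ => ?_⟩
  obtain ⟨p⟩ := h.preconnected a b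
  obtain ⟨d, -, h1, h2⟩ := p.exists_boundary_dart (A : Set V) (by simpa using ha)
    (by simpa using hb)
  exact dartCount_pos_iff.mpr ⟨d.fst, by simpa using h1, d.snd, by simpa using h2, d.adj⟩

/-- The converse of `inducesConnected_univ`, for a parametrised vertex set. -/
theorem connected_comap {q : ℕ} (v : Fin q ↪ V) (h : InducesConnected G (Finset.univ.map v)) :
    (G.comap v).Connected := by
  classical
  obtain ⟨x, hx⟩ := h.1
  obtain ⟨i₀, -, -⟩ := Finset.mem_map.mp hx
  refine { preconnected := fun i j => ?_, nonempty := ⟨i₀⟩ }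
  by_contra hij
  have := h.2 (({k | (G.comap v).Reachable i k} : Finset (Fin q)).map v)
    (Finset.map_subset_map.mpr (Finset.subset_univ _))
    ⟨v i, by simp⟩ ⟨v j, by simp [hij]⟩
  obtain ⟨a, ha, b, hb, hab⟩ := dartCount_pos_iff.mp this
  simp only [Finset.mem_map, Finset.mem_sdiff, Finset.mem_filter, Finset.mem_univ,
    true_and] at ha hb
  obtain ⟨k, hk, rfl⟩ := ha
  obtain ⟨⟨l, rfl⟩, hl⟩ := hb
  exact hl ⟨l, hk.trans (SimpleGraph.Adj.reachable (by simpa using hab)), rfl⟩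

theorem isTree_comap {q : ℕ} (v : Fin q ↪ V) (h : InducesConnected G (Finset.univ.map v))
    (hc : dartCount G (Finset.univ.map v) (Finset.univ.map v) + 2 = 2 * q) :
    (G.comap v).IsTree := by
  classical
  rw [SimpleGraph.isTree_iff_connected_and_card]
  refine ⟨connected_comap v h, ?_⟩
  have h1 := dartCount_univ (G := G.comap v)
  have h2 : dartCount (G.comap v) Finset.univ Finset.univ =
      dartCount G (Finset.univ.map v) (Finset.univ.map v) := by
    simp only [dartCount, Finset.sum_map, SimpleGraph.comap_adj]
  rw [Nat.card_coe_set_eq, Nat.card_fin]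
  omega

theorem InducesPure.nonempty_specialData [Fintype V] {W : Finset V}
    (h : InducesPure G Finset.univ W) : Nonempty (SpecialData G 3 W.card 0) := by
  classical
  obtain ⟨u, l⟩ := h.exists_listing
  obtain ⟨hW, hWc⟩ := h.connections
  let e := W.equivFin.symm
  let v : Fin W.card ↪ V := e.toEmbedding.trans (Function.Embedding.subtype _)
  have hv : ∀ i, v i ∈ W := fun i => (e i).2
  have hv' : ∀ w ∈ W, ∃ i, v i = w := fun w hw => ⟨e.symm ⟨w, hw⟩, by simp [v]⟩
  have hmap : Finset.univ.map v = W := by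
    ext w
    simp only [Finset.mem_map, Finset.mem_univ, true_and]
    exact ⟨fun ⟨i, hi⟩ => hi ▸ hv i, hv' w⟩
  obtain ⟨w₀, hw₀⟩ := hW.1
  obtain ⟨i₀, hi₀⟩ := hv' w₀ hw₀
  have huniv : ∀ x, x ∈ W ∨ ∃ w ∈ W, ∃ i, x = u w i := fun x =>
    (em (x ∈ W)).imp_right (l.exists_eq x (Finset.mem_univ x))
  refine ⟨{
    v := v
    u := fun i => ⟨u (v i), fun a b hab => (l.eq _ (hv i) _ (hv i) a b hab).2⟩
    u_disjoint := ?_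
    u_ne_v := fun i j a hij => l.notMem _ (hv i) a (by
      rw [show u (v i) a = v j from hij]; exact hv j)
    quotient := G.comap v
    quotient_isTree := isTree_comap v (by rwa [hmap]) (by rw [hmap, hWc])
    -- With `r = 0` the remainder tree is a single vertex, which may be any connection.
    remainder := G.singletonSubgraph (v i₀)
    remainder_isTree := ?_
    remainder_card := by simp
    root := i₀
    remainder_inter := ?_
    verts_eq := ?_
    graph_eq := ?_ }⟩
  · intro i j hij
    rw [Set.disjoint_left]
    rintro _ ⟨a, rfl⟩ ⟨b, hb⟩
    exact hij (v.injective (l.eq _ (hv j) _ (hv i) b a hb).1.symm)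
  · have : Subsingleton (G.singletonSubgraph (v i₀)).verts :=
      ⟨fun ⟨x, hx⟩ ⟨y, hy⟩ => Subtype.ext
        ((show x = v i₀ from hx).trans (show y = v i₀ from hy).symm)⟩
    have : Nonempty (G.singletonSubgraph (v i₀)).verts := ⟨⟨v i₀, rfl⟩⟩
    exact .of_subsingleton
  · rw [SimpleGraph.singletonSubgraph_verts, Set.inter_eq_left, Set.singleton_subset_iff]
    exact Set.mem_iUnion.mpr ⟨i₀, Set.mem_insert _ _⟩
  · rw [Set.eq_univ_iff_forall]
    intro x
    right
    rw [Set.mem_iUnion]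
    rcases huniv x with hx | ⟨w, hw, a, rfl⟩
    · obtain ⟨i, rfl⟩ := hv' x hx
      exact ⟨i, Set.mem_insert _ _⟩
    · obtain ⟨i, rfl⟩ := hv' w hw
      exact ⟨i, Or.inr ⟨a, rfl⟩⟩
  · ext x y
    simp only [SimpleGraph.sup_adj, SimpleGraph.iSup_adj, SimpleGraph.map_adj,
      SimpleGraph.edge_adj, SimpleGraph.Subgraph.spanningCoe_adj, SimpleGraph.comap_adj,
      SimpleGraph.singletonSubgraph_adj, SimpleGraph.top_adj]
    have hu : ∀ w ∈ W, ∀ a y, G.Adj (u w a) y → ∃ i,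
        (∃ b c, b ≠ c ∧ u (v i) b = u w a ∧ u (v i) c = y) ∨ (u w a = u (v i) 0 ∧ y = v i) := by
      intro w hw a y hy
      obtain ⟨i, rfl⟩ := hv' w hw
      refine ⟨i, ?_⟩
      rcases l.of_adj _ hw a y (Finset.mem_univ _) hy with ⟨b, rfl⟩ | ⟨rfl, rfl⟩
      · exact Or.inl ⟨a, b, by rintro rfl; exact hy.ne rfl, rfl, rfl⟩
      · exact Or.inr ⟨rfl, rfl⟩
    constructor
    · intro hxy
      rcases huniv x with hx | ⟨w, hw, a, rfl⟩
      · rcases huniv y with hy | ⟨w, hw, a, rfl⟩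
        · obtain ⟨i, rfl⟩ := hv' x hx
          obtain ⟨j, rfl⟩ := hv' y hy
          exact Or.inl (Or.inl ⟨i, j, hxy, rfl, rfl⟩)
        · right
          obtain ⟨i, ⟨b, c, hbc, h1, h2⟩ | ⟨h1, h2⟩⟩ := hu w hw a x hxy.symm
          · exact ⟨i, Or.inl ⟨c, b, hbc.symm, h2, h1⟩⟩
          · exact ⟨i, Or.inr ⟨Or.inr ⟨h2, h1⟩, hxy.ne⟩⟩
      · right
        obtain ⟨i, ⟨b, c, hbc, h1, h2⟩ | ⟨h1, h2⟩⟩ := hu w hw a y hxy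
        · exact ⟨i, Or.inl ⟨b, c, hbc, h1, h2⟩⟩
        · exact ⟨i, Or.inr ⟨Or.inl ⟨h1, h2⟩, hxy.ne⟩⟩
    · rintro ((⟨i, j, hij, rfl, rfl⟩ | h) | ⟨i, ⟨a, b, hab, rfl, rfl⟩ | ⟨⟨rfl, rfl⟩ | ⟨rfl, rfl⟩, -⟩⟩)
      · exact hij
      · simp at h
      · exact l.adj _ (hv i) a b hab
      · exact (l.adj_zero _ (hv i)).symm
      · exact l.adj_zero _ (hv i)

end Pure

/-! ### Isolation numbers, lower bounds and the exceptional cycles -/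

section Isolating

variable {V : Type u} {G : SimpleGraph V}

theorem IsIsolating.isolationNumber_le {F : GraphFamily} {D : Finset V} (h : IsIsolating G F D) :
    isolationNumber G F ≤ D.card :=
  Nat.sInf_le ⟨D, h, rfl⟩

theorem InducesForest.isIsolating [Fintype V] [DecidableEq V] [DecidableRel G.Adj] {D : Finset V}
    (h : InducesForest G (undominated G Finset.univ D)) : IsIsolating G cycles D := by
  rintro _ ⟨n, hn, rfl⟩ ⟨f⟩
  obtain ⟨n, rfl⟩ : ∃ k, n = k + 3 := ⟨n - 3, by omega⟩
  let g : Fin (n + 3) → V := fun i => (f i).1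
  have hg : Function.Injective g := Subtype.val_injective.comp f.injective
  have hadj : ∀ i, G.Adj (g i) (g (i + 1)) := by
    intro i
    have : (SimpleGraph.cycleGraph (n + 3)).Adj i (i + 1) := by
      rw [SimpleGraph.cycleGraph_adj]
      simp
    exact f.toHom.map_adj this
  have h1 := h (Finset.univ.image g) (by
    intro w hw
    obtain ⟨i, -, rfl⟩ := Finset.mem_image.mp hw
    rw [mem_undominated]
    refine ⟨Finset.mem_univ _, fun v hv => ?_⟩
    have : g i ∉ closedNbhd G (D : Set V) := (f i).2
    rw [closedNbhd, Set.mem_ofPred_eq] at this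
    push Not at this
    exact this v hv) (Finset.univ_nonempty.image _)
  -- Both orientations of the cycle's edges give twice as many darts as vertices, too many for a
  -- forest. They are distinct because `1 + 1 ≠ 0` modulo a length of at least 3.
  have h2 := card_le_dartCount (G := G) (A := Finset.univ.image g) (B := Finset.univ.image g)
    ((Finset.univ.image fun i => (g i, g (i + 1))) ∪ (Finset.univ.image fun i => (g (i + 1), g i)))
    (by
      intro p hp
      simp only [Finset.mem_union, Finset.mem_image, Finset.mem_univ, true_and] at hp
      rcases hp with ⟨i, rfl⟩ | ⟨i, rfl⟩
      · simp [hadj i]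
      · simp [(hadj i).symm])
  rw [Finset.card_union_of_disjoint, Finset.card_image_of_injective, Finset.card_image_of_injective]
    at h2
  · rw [Finset.card_image_of_injective _ hg] at h1
    omega
  · intro i j hij
    exact hg (Prod.mk.inj hij).2
  · intro i j hij
    exact hg (Prod.mk.inj hij).1
  · rw [Finset.disjoint_left]
    rintro p hp hp'
    obtain ⟨i, -, rfl⟩ := Finset.mem_image.mp hp
    obtain ⟨j, -, hj⟩ := Finset.mem_image.mp hp'
    have e1 := hg (Prod.mk.inj hj).1
    have e2 := hg (Prod.mk.inj hj).2
    rw [e2, add_assoc] at e1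
    have e3 : (1 + 1 : Fin (n + 3)) = 0 := by simpa using e1
    have := congrArg Fin.val e3
    simp [Fin.val_add] at this
    rw [Nat.mod_eq_of_lt (by omega)] at this
    omega

/-- A special graph with `q` constituents needs `q` vertices to isolate its cycles. -/
theorem SpecialData.le_isolationNumber [Finite V] {q r : ℕ} (d : SpecialData G 3 q r) :
    q ≤ isolationNumber G cycles := by
  obtain ⟨D, hD, hDc⟩ := exists_isIsolating_cycles G
  rw [← hDc]
  have hG : ∀ x y, G.Adj x y ↔ ((∃ i j, d.quotient.Adj i j ∧ d.v i = x ∧ d.v j = y) ∨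
      d.remainder.Adj x y) ∨ ∃ i, (∃ a b, a ≠ b ∧ d.u i a = x ∧ d.u i b = y) ∨
        (x = d.u i 0 ∧ y = d.v i ∨ x = d.v i ∧ y = d.u i 0) ∧ x ≠ y := by
    intro x y
    conv_lhs => rw [d.graph_eq]
    simp only [SimpleGraph.sup_adj, SimpleGraph.iSup_adj, SimpleGraph.map_adj,
      SimpleGraph.edge_adj, SimpleGraph.Subgraph.spanningCoe_adj, SimpleGraph.top_adj]
  have hui : ∀ i j a b, d.u i a = d.u j b → i = j := by
    intro i j a b h
    by_contra hij
    exact Set.disjoint_left.mp (d.u_disjoint i j hij) ⟨a, rfl⟩ ⟨b, h.symm⟩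
  -- The remainder meets the constituents only in a connection, and the quotient only joins
  -- connections, so triangle vertices have no neighbours elsewhere.
  have hloc : ∀ i a y, G.Adj (d.u i a) y → y ∈ insert (d.v i) (Set.range (d.u i)) := by
    intro i a y h
    rcases (hG _ _).mp h with (⟨j, k, -, h, -⟩ | h) | ⟨j, ⟨b, c, -, h1, rfl⟩ | ⟨⟨h1, rfl⟩ | ⟨h1, -⟩, -⟩⟩
    · exact absurd h.symm (d.u_ne_v i j a)
    · have : d.u i a ∈ d.remainder.verts ∩ ⋃ i, insert (d.v i) (Set.range (d.u i)) :=
        ⟨h.fst_mem, Set.mem_iUnion.mpr ⟨i, Or.inr ⟨a, rfl⟩⟩⟩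
      rw [d.remainder_inter] at this
      exact absurd this (d.u_ne_v i _ a)
    · obtain rfl := hui _ _ _ _ h1
      exact Or.inr ⟨c, rfl⟩
    · obtain rfl := hui _ _ _ _ h1
      exact Or.inl rfl
    · exact absurd h1 (d.u_ne_v i j a)
  have hmeet : ∀ i, ∃ x ∈ D, x ∈ insert (d.v i) (Set.range (d.u i)) := by
    intro i
    by_contra hno
    push Not at hno
    -- If `D` misses a constituent, its triangle survives as a copy of `C_3`.
    refine hD _ ⟨3, le_rfl, rfl⟩ ⟨⟨⟨fun a => ⟨d.u i a, ?_⟩, ?_⟩, ?_⟩⟩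
    · rintro ⟨x, hx, h | h⟩
      · exact hno x hx (h ▸ Or.inr ⟨a, rfl⟩)
      · exact hno x hx (hloc i a x h.symm)
    · intro a b hab
      exact (hG _ _).mpr (Or.inr ⟨i, Or.inl ⟨a, b, hab.ne, rfl, rfl⟩⟩)
    · intro a b hab
      exact (d.u i).injective (congrArg Subtype.val hab)
  choose x hxD hx using hmeet
  have hinj : Function.Injective fun i => (⟨x i, hxD i⟩ : D) := by
    intro i j hij
    have hij : x i = x j := congrArg Subtype.val hij
    have h1 := hx i
    rw [hij] at h1
    rcases h1 with h1 | ⟨a, ha⟩ <;> rcases hx j with h2 | ⟨b, hb⟩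
    · exact d.v.injective (h1.symm.trans h2)
    · exact absurd (hb.trans h1) (d.u_ne_v j i b)
    · exact absurd (ha.trans h2) (d.u_ne_v i j a)
    · exact hui i j a b (ha.trans hb.symm)
  simpa using Fintype.card_le_of_injective _ hinj

theorem one_le_isolationNumber_of_iso_cycleGraph_four [Finite V]
    (e : G ≃g SimpleGraph.cycleGraph 4) : 1 ≤ isolationNumber G cycles := by
  obtain ⟨D, hD, hDc⟩ := exists_isIsolating_cycles G
  by_contra h0
  obtain rfl : D = ∅ := Finset.card_eq_zero.mp (by omega)
  refine hD _ ⟨4, by norm_num, rfl⟩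
    ⟨⟨⟨fun a => ⟨e.symm a, ?_⟩, ?_⟩, ?_⟩⟩
  · rintro ⟨x, hx, -⟩
    simp at hx
  · intro a b hab
    exact e.symm.map_adj_iff.mpr hab
  · intro a b hab
    exact e.symm.injective (congrArg Subtype.val hab)

theorem ncard_edgeSet_of_iso_cycleGraph_four [Finite V]
    (e : G ≃g SimpleGraph.cycleGraph 4) : G.edgeSet.ncard = 4 := by
  classical
  have := Fintype.ofFinite V
  rw [← SimpleGraph.coe_edgeFinset, Set.ncard_coe_finset, e.card_edgeFinset_eq]
  convert (by decide : (SimpleGraph.cycleGraph 4).edgeFinset.card = 4)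

theorem nonempty_iso_cycleGraph_three [Fintype V] (h : G.IsNClique 3 Finset.univ) :
    Nonempty (G ≃g SimpleGraph.cycleGraph 3) := by
  have hG : G = ⊤ := by
    ext x y
    exact ⟨SimpleGraph.Adj.ne, fun hxy => h.isClique (by simp) (by simp) hxy⟩
  subst hG
  rw [SimpleGraph.cycleGraph_three_eq_top]
  exact ⟨SimpleGraph.Iso.completeGraph (Fintype.equivFinOfCardEq h.card_eq)⟩

theorem InducesSquare.nonempty_iso [Fintype V] [DecidableEq V] [DecidableRel G.Adj]
    (h : InducesSquare G Finset.univ) : Nonempty (G ≃g SimpleGraph.cycleGraph 4) := by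
  obtain ⟨hc, hd, -⟩ := h
  obtain ⟨v⟩ : Nonempty V := Fintype.card_pos_iff.mp (by rw [← Finset.card_univ, hc]; norm_num)
  have hN := hd v (Finset.mem_univ v)
  rw [dartCount_singleton_left] at hN
  obtain ⟨a, b, hab, hNe⟩ := Finset.card_eq_two.mp hN
  have hv : ∀ x, G.Adj v x ↔ x = a ∨ x = b := fun x => by
    have : x ∈ ({w | G.Adj v w} : Finset V) ↔ x ∈ ({a, b} : Finset V) := by rw [hNe]
    simpa using this
  have hva := (hv a).mpr (Or.inl rfl)
  have hvb := (hv b).mpr (Or.inr rfl)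
  have h3 : ({v, a, b} : Finset V).card = 3 :=
    Finset.card_eq_three.mpr ⟨v, a, b, hva.ne, hvb.ne, hab, rfl⟩
  obtain ⟨c, -, hcn⟩ := Finset.exists_mem_notMem_of_card_lt_card
    (show ({v, a, b} : Finset V).card < Finset.univ.card by rw [h3, hc]; norm_num)
  simp only [Finset.mem_insert, Finset.mem_singleton, not_or] at hcn
  obtain ⟨hcv, hca, hcb⟩ := hcn
  have huniv : (Finset.univ : Finset V) = {v, a, b, c} := by
    refine (Finset.eq_of_subset_of_card_le (Finset.subset_univ _) ?_).symm
    rw [hc, Finset.card_insert_of_notMem (by simp [hva.ne, hvb.ne, Ne.symm hcv]),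
      Finset.card_eq_three.mpr ⟨a, b, c, hab, Ne.symm hca, Ne.symm hcb, rfl⟩]
  have hvc : ¬ G.Adj v c := by rw [hv]; tauto
  have hd' : ∀ x, (if G.Adj x v then 1 else 0) + ((if G.Adj x a then 1 else 0) +
      ((if G.Adj x b then 1 else 0) + (if G.Adj x c then 1 else 0))) = 2 := by
    intro x
    rw [← hd x (Finset.mem_univ x), huniv,
      dartCount_singleton_insert x (b := v) (by simp [hva.ne, hvb.ne, Ne.symm hcv]),
      dartCount_singleton_insert x (b := a) (by simp [hab, Ne.symm hca]),
      dartCount_singleton_insert x (b := b) (by simp [Ne.symm hcb]), dartCount_singleton]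
  have hdc := hd' c
  have hda := hd' a
  simp only [G.adj_comm c v, hvc, SimpleGraph.irrefl, if_false] at hdc
  have hcA : G.Adj c a := by
    by_contra h
    simp only [h, if_false] at hdc
    split_ifs at hdc <;> omega
  have hcB : G.Adj c b := by
    by_contra h
    simp only [h, if_false] at hdc
    split_ifs at hdc
    omega
  have hnab : ¬ G.Adj a b := by
    intro h
    simp [h, hva.symm, hcA.symm] at hda
  have hf : Function.Bijective (![v, a, c, b] : Fin 4 → V) := by
    rw [Fintype.bijective_iff_injective_and_card, ← Finset.card_univ (α := V), hc]
    refine ⟨?_, by simp⟩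
    intro i j hij
    fin_cases i <;> fin_cases j <;>
      simp [hva.ne, hvb.ne, hcv, hca, hcb, hab, hva.ne', hvb.ne', Ne.symm hcv, Ne.symm hca,
        Ne.symm hcb, hab.symm] at hij ⊢
  refine ⟨SimpleGraph.Iso.symm ⟨Equiv.ofBijective _ hf, ?_⟩⟩
  intro i j
  fin_cases i <;> fin_cases j <;>
    simp [SimpleGraph.cycleGraph_adj, hva, hvb, hcA, hcB, hvc, hnab, hva.symm, hvb.symm,
      hcA.symm, hcB.symm, G.adj_comm c v, G.adj_comm b a] <;> decide

theorem five_mul_isolationNumber_le [Finite V] (hconn : G.Connected)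
    (htri : ¬ Nonempty (G ≃g SimpleGraph.cycleGraph 3)) :
    5 * isolationNumber G cycles ≤ G.edgeSet.ncard + 1 := by
  classical
  have := Fintype.ofFinite V
  have hu := inducesConnected_univ hconn
  obtain ⟨D, hD, hc⟩ := (hu.classified).exists_isolating hu
    fun h => htri (nonempty_iso_cycleGraph_three h)
  have := hD.isIsolating.isolationNumber_le
  rw [dartCount_univ] at hc
  omega

theorem isPureSpecial_or_of_five_mul_isolationNumber_eq [Finite V] (hconn : G.Connected)
    (htri : ¬ Nonempty (G ≃g SimpleGraph.cycleGraph 3))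
    (h : 5 * isolationNumber G cycles = G.edgeSet.ncard + 1) :
    IsPureSpecial G G.edgeSet.ncard 3 ∨ Nonempty (G ≃g SimpleGraph.cycleGraph 4) := by
  classical
  have := Fintype.ofFinite V
  have h5 : constituentWeight 3 = 5 := rfl
  rcases (inducesConnected_univ hconn).classified with h1 | ⟨D, hD, hc⟩ | ⟨W, hW⟩ | h1
  · exact absurd (nonempty_iso_cycleGraph_three h1) htri
  · have := hD.isIsolating.isolationNumber_le
    rw [dartCount_univ] at hc
    omega
  · left
    have hc := hW.dartCount_self
    rw [dartCount_univ] at hc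
    have hm : G.edgeSet.ncard + 1 = 5 * W.card := by omega
    have hq : (G.edgeSet.ncard + 1) / constituentWeight 3 = W.card := by rw [h5]; omega
    have hr : (G.edgeSet.ncard + 1) % constituentWeight 3 = 0 := by rw [h5]; omega
    refine ⟨Or.inr ⟨by rw [hq]; omega, ?_⟩, hr⟩
    rw [hq, hr]
    exact hW.nonempty_specialData
  · exact Or.inr h1.nonempty_iso

theorem IsSpecial.div_le_isolationNumber [Finite V] {m : ℕ} (h : IsSpecial G m 3) :
    (m + 1) / 5 ≤ isolationNumber G cycles := by
  have h5 : constituentWeight 3 = 5 := rfl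
  rcases h with ⟨h, -⟩ | ⟨-, ⟨d⟩⟩
  · rw [h5] at h; omega
  · exact d.le_isolationNumber

end Isolating

end Isolation

/-! ### Assembly of the bounds -/

theorem mainTheorem2 {V : Type*} [Finite V] (G : SimpleGraph V) (m : ℕ)
    (hconn : G.Connected) (hm : G.edgeSet.ncard = m)
    (htri : ¬ Nonempty (G ≃g SimpleGraph.cycleGraph 3)) :
    (Isolation.isolationNumber G Isolation.cycles : ℚ) ≤ ((m : ℚ) + 1) / 5 ∧
    ((Isolation.isolationNumber G Isolation.cycles : ℚ) = ((m : ℚ) + 1) / 5 ↔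
      Isolation.IsPureSpecial G m 3 ∨ Nonempty (G ≃g SimpleGraph.cycleGraph 4)) ∧
    (Isolation.IsSpecial G m 3 →
      (Isolation.isolationNumber G Isolation.cycles : ℤ) = ⌊((m : ℚ) + 1) / 5⌋) := by
  have hle := Isolation.five_mul_isolationNumber_le hconn htri
  rw [hm] at hle
  have hiff : (Isolation.isolationNumber G Isolation.cycles : ℚ) = ((m : ℚ) + 1) / 5 ↔
      5 * Isolation.isolationNumber G Isolation.cycles = m + 1 := by
    rw [eq_div_iff (by norm_num), mul_comm]
    norm_cast
  refine ⟨?_, ?_, ?_⟩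
  · rw [le_div_iff₀ (by norm_num), mul_comm]
    exact_mod_cast hle
  · rw [hiff]
    constructor
    · intro h
      subst hm
      exact Isolation.isPureSpecial_or_of_five_mul_isolationNumber_eq hconn htri h
    · rintro (⟨h, hr⟩ | ⟨⟨e⟩⟩)
      · have h1 := h.div_le_isolationNumber
        have hr : (m + 1) % 5 = 0 := hr
        omega
      · have h1 := Isolation.one_le_isolationNumber_of_iso_cycleGraph_four e
        have h2 := Isolation.ncard_edgeSet_of_iso_cycleGraph_four e
        omega
  · intro h
    have h1 := h.div_le_isolationNumber
    have h2 : m + 1 < 5 * (Isolation.isolationNumber G Isolation.cycles + 1) := by omega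
    symm
    rw [Int.floor_eq_iff]
    constructor
    · rw [le_div_iff₀ (by norm_num), mul_comm]
      exact_mod_cast hle
    · rw [div_lt_iff₀ (by norm_num), mul_comm]
      exact_mod_cast h2
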